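/- Let $\overline{\Sigma}$ be a compact connected orbifold Riemann surface with strictly negative orbifold Euler characteristic $\chi(\Sigma)-\sum_i(1-\frac1{q_i})<0$, where $A_1,\dots,A_s$ are its (distinct) singular points and $q_i$ is the order of the isotropy group of $A_i$; suppose $q_i>2$ for all $i$. Let $\mathcal K_{orb}$ be the orbifold canonical bundle (the canonical bundle $\mathcal K_U$ on every orbifold chart $U$), let $q=2r$ be an even integer, and let $\pi:\overline M=\mathbb P(\mathcal O\oplus\mathcal K_{orb}^{r})\to\overline\Sigma$ be the projectivized orbifold bundle. 1. If no $q_i$ divides $r$, then the complex surface $\overline M$ has exactly $2s$ singular points, exactly two of them in each fibre $\pi^{-1}(A_i)$. 2. For every $i$ with $\gcd(r,q_i)=1$, the fibre $\pi^{-1}(A_i)$ contains exactly two singular points of $\overline M$; these are also exactly the points of the fibre with non-trivial isotropy group in the orbifold $\overline M$. One of them is of type $A_{p_i,q_i}$ and the other one is of type $A_{q_i-p_i,q_i}$, where $0<p_i<q_i$ and $p_i\equiv -r \pmod{q_i}$. Here, for coprime integers $0<p<q$, a singularity of type $A_{p,q}$ is a point whose germ is isomorphic, as a germ of complex spaces,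 to the germ at $0$ of $\mathbb C^2/\Gamma_{p,q}$, where $\Gamma_{p,q}\subset U(2)$ is generated by $\mathrm{diag}(e^{2\pi i/q},e^{2\pi i p/q})$. -/

import Mathlib

open Topology Filter

universe u v

noncomputable section

/-! ### Orbifold Riemann surfaces -/

/-- An orbifold chart of complex dimension one on a topological space `X`: a connected open set
`domain ⊆ ℂ`, a finite group `G` acting on it effectively by holomorphic maps, and a map
`toFun : domain → X` inducing a homeomorphism of `domain / G` onto an open subset of `X`.
(Only the values of `act g` and `toFun` on `domain` matter.) -/
structure OrbifoldChart (X : Type u) [TopologicalSpace X] where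
  domain : Set ℂ
  isOpen_domain : IsOpen domain
  isConnected_domain : IsConnected domain
  G : Type
  [group : Group G]
  [finite : Finite G]
  act : G → ℂ → ℂ
  act_mem : ∀ g, ∀ z ∈ domain, act g z ∈ domain
  act_one : ∀ z ∈ domain, act 1 z = z
  act_mul : ∀ g h, ∀ z ∈ domain, act (g * h) z = act g (act h z)
  act_holomorphic : ∀ g, DifferentiableOn ℂ (act g) domain
  act_effective : ∀ g, (∀ z ∈ domain, act g z = z) → g = 1
  toFun : ℂ → X
  continuousOn_toFun : ContinuousOn toFun domain
  isOpen_image : ∀ V ⊆ domain, IsOpen V → IsOpen (toFun '' V)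
  toFun_eq_iff : ∀ z ∈ domain, ∀ w ∈ domain, toFun z = toFun w ↔ ∃ g, act g z = w

attribute [instance] OrbifoldChart.group OrbifoldChart.finite

/-- `h` is (the germ at `z` of) a biholomorphic change of charts from the orbifold chart `c`
near `z` to the orbifold chart `d` near `w`. -/
structure IsTransition {X : Type u} [TopologicalSpace X] (c d : OrbifoldChart X)
    (h : ℂ → ℂ) (z w : ℂ) : Prop where
  mem_left : z ∈ c.domain
  mem_right : w ∈ d.domain
  analyticAt : AnalyticAt ℂ h z
  map_eq : h z = w
  deriv_ne_zero : deriv h z ≠ 0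
  comm : ∀ᶠ t in 𝓝 z, d.toFun (h t) = c.toFun t

/-- An orbifold Riemann surface structure on the topological space `X`, given by an atlas of
orbifold charts: the charts cover `X`, and any two of them are related, near any two points over
the same point of `X`, by a biholomorphic change of charts. -/
structure OrbifoldRiemannSurface (X : Type u) [TopologicalSpace X] where
  ι : Type v
  chart : ι → OrbifoldChart X
  covers : ∀ x, ∃ i, ∃ z ∈ (chart i).domain, (chart i).toFun z = x
  compatible : ∀ i j, ∀ z ∈ (chart i).domain, ∀ w ∈ (chart j).domain,
    (chart i).toFun z = (chart j).toFun w → ∃ h, IsTransition (chart i) (chart j) h z w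

namespace OrbifoldRiemannSurface

variable {X : Type u} [TopologicalSpace X] (S : OrbifoldRiemannSurface.{u, v} X)

/-- The order of a point `x`: the order of its isotropy group, i.e. of the stabilizer, in the
group of an orbifold chart, of a point over `x` (up to isomorphism the stabilizer does not depend
on the chart nor on the point over `x`). -/
def order (x : X) : ℕ :=
  let i := (S.covers x).choose
  let z := (S.covers x).choose_spec.choose
  Nat.card {g : (S.chart i).G // (S.chart i).act g z = z}

/-- The singular points (cone points) of an orbifold Riemann surface. -/
def conePoints : Set X := {x | S.order x ≠ 1}

end OrbifoldRiemannSurface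

/-- The topological Euler characteristic, the alternating sum of the dimensions of the singular
homology groups with rational coefficients. -/
def topologicalEulerChar (X : Type u) [TopologicalSpace X] : ℤ :=
  (((AlgebraicTopology.singularChainComplexFunctor (ModuleCat.{u} ℚ)).obj
    (ModuleCat.of ℚ (ULift.{u} ℚ))).obj (TopCat.of X)).homologyEulerChar

/-- The orbifold Euler characteristic `χ(X) - ∑ (1 - 1 / q_x)`, the sum being over the (finitely
many, if `X` is compact) cone points `x`, of order `q_x`. -/
def OrbifoldRiemannSurface.orbifoldEulerChar {X : Type u} [TopologicalSpace X]
    (S : OrbifoldRiemannSurface.{u, v} X) : ℚ :=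
  topologicalEulerChar X - ∑ᶠ x : X, (1 - 1 / (S.order x : ℚ))

/-! ### Changes of charts form a pseudogroup -/

section Pseudogroup

variable {X : Type u} [TopologicalSpace X]

theorem IsTransition.id (c : OrbifoldChart X) {z : ℂ} (hz : z ∈ c.domain) :
    IsTransition c c (fun t => t) z z :=
  ⟨hz, hz, analyticAt_id, rfl, by simp, Eventually.of_forall fun _ => rfl⟩

theorem IsTransition.comp {c d e : OrbifoldChart X} {h k : ℂ → ℂ} {x y z : ℂ}
    (hk : IsTransition d e k y z) (hh : IsTransition c d h x y) :
    IsTransition c e (k ∘ h) x z ∧ deriv (k ∘ h) x = deriv k y * deriv h x := by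
  have hy : h x = y := hh.map_eq
  subst hy
  have hd : deriv (k ∘ h) x = deriv k (h x) * deriv h x :=
    deriv_comp x hk.analyticAt.differentiableAt hh.analyticAt.differentiableAt
  refine ⟨⟨hh.mem_left, hk.mem_right, hk.analyticAt.comp hh.analyticAt, hk.map_eq, ?_, ?_⟩, hd⟩
  · rw [hd]
    exact mul_ne_zero hk.deriv_ne_zero hh.deriv_ne_zero
  · filter_upwards [hh.comm, hh.analyticAt.continuousAt.eventually hk.comm] with t h1 h2
    simpa [h1] using h2

theorem IsTransition.inv {c d : OrbifoldChart X} {h : ℂ → ℂ} {z w : ℂ}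
    (hh : IsTransition c d h z w) :
    ∃ k, IsTransition d c k w z ∧ deriv k w = (deriv h z)⁻¹ := by
  have hw : h z = w := hh.map_eq
  subst hw
  have hs := hh.analyticAt.hasStrictDerivAt
  let k := hs.localInverse _ _ _ hh.deriv_ne_zero
  have hk : HasStrictDerivAt k (deriv h z)⁻¹ (h z) := hs.to_localInverse hh.deriv_ne_zero
  have hkz : k (h z) = z := HasStrictFDerivAt.localInverse_apply_image ..
  have hr : ∀ᶠ t in 𝓝 (h z), h (k t) = t :=
    HasStrictDerivAt.eventually_right_inverse ..
  have hkd : deriv k (h z) = (deriv h z)⁻¹ := hk.hasDerivAt.deriv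
  have ht : Tendsto k (𝓝 (h z)) (𝓝 z) := by
    have := hk.hasDerivAt.continuousAt.tendsto
    rwa [hkz] at this
  refine ⟨k, ⟨hh.mem_right, hh.mem_left, hh.analyticAt.analyticAt_localInverse hh.deriv_ne_zero,
    hkz, ?_, ?_⟩, hkd⟩
  · rw [hkd]
    exact inv_ne_zero hh.deriv_ne_zero
  · filter_upwards [hr, ht.eventually hh.comm] with t h1 h2
    rw [← h2, h1]

end Pseudogroup

/-! ### The orbifold `ℙ(𝒪 ⊕ K_orb ^ r)` -/

namespace OrbifoldRiemannSurface

variable {X : Type u} [TopologicalSpace X] (S : OrbifoldRiemannSurface.{u, v} X)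

/-- Nonzero vectors of the orbifold vector bundle `𝒪 ⊕ K_orb ^ r` in the charts of `S`: the triple
`(z, a, b)` over the chart `i` stands for the vector `(a, b (dz) ^ r)` in the fibre over `z`, where
`z` is the coordinate of the `i`-th chart. -/
abbrev FrameVector : Type v :=
  Σ i : S.ι, {p : ℂ × ℂ × ℂ // p.1 ∈ (S.chart i).domain ∧ p.2 ≠ 0}

/-- Two nonzero vectors of `𝒪 ⊕ K_orb ^ r` span the same line. A change of charts `w = h z`
satisfies `dw = h'(z) dz`, hence it maps the vector `(a, b (dz) ^ r)` to
`(a, b h'(z) ^ (-r) (dw) ^ r)`. -/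
def SameLine (r : ℤ) (P Q : S.FrameVector) : Prop :=
  ∃ h : ℂ → ℂ, IsTransition (S.chart P.1) (S.chart Q.1) h P.2.1.1 Q.2.1.1 ∧
    ∃ c : ℂ, c ≠ 0 ∧ Q.2.1.2.1 = c * P.2.1.2.1 ∧
      Q.2.1.2.2 = c * (P.2.1.2.2 * deriv h P.2.1.1 ^ (-r))

/-- The equivalence relation on nonzero vectors of `𝒪 ⊕ K_orb ^ r` whose quotient is the
projectivization. -/
def sameLineSetoid (r : ℤ) : Setoid S.FrameVector where
  r := S.SameLine r
  iseqv := by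
    refine ⟨fun P => ?_, fun {P Q} => ?_, fun {P Q R} => ?_⟩
    · exact ⟨_, IsTransition.id _ P.2.2.1, 1, one_ne_zero, by simp, by simp⟩
    · rintro ⟨h, hh, c, hc, h1, h2⟩
      obtain ⟨k, hk, hkd⟩ := hh.inv
      have hne := zpow_ne_zero r hh.deriv_ne_zero
      refine ⟨k, hk, c⁻¹, inv_ne_zero hc, ?_, ?_⟩
      · rw [h1]
        field_simp
      · rw [h2, hkd, inv_zpow', neg_neg, zpow_neg]
        field_simp
    · rintro ⟨h, hh, c, hc, h1, h2⟩ ⟨k, hk, d, hd, h3, h4⟩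
      obtain ⟨hkh, hder⟩ := hk.comp hh
      refine ⟨_, hkh, d * c, mul_ne_zero hd hc, ?_, ?_⟩
      · rw [h3, h1]
        ring
      · rw [h4, h2, hder, mul_zpow]
        ring

/-- The total space of the projectivized orbifold bundle `ℙ(𝒪 ⊕ K_orb ^ r)`, with the quotient
topology. -/
abbrev ProjBundle (r : ℤ) : Type v := Quotient (S.sameLineSetoid r)

variable {S} {r : ℤ}

/-- The point `[a : b (dz) ^ r]` over the point with coordinate `z` in the `i`-th chart. -/
def ProjBundle.mk (r : ℤ) (P : S.FrameVector) : S.ProjBundle r :=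
  Quotient.mk (S.sameLineSetoid r) P

/-- The projection `ℙ(𝒪 ⊕ K_orb ^ r) → X`. -/
def ProjBundle.proj : S.ProjBundle r → X :=
  Quotient.lift (fun P : S.FrameVector => (S.chart P.1).toFun P.2.1.1) (by
    rintro P Q ⟨h, hh, -⟩
    have := hh.comm.self_of_nhds
    rw [hh.map_eq] at this
    exact this.symm)

/-- Holomorphic functions on a subset `V` of the complex space `ℙ(𝒪 ⊕ K_orb ^ r)`: functions whose
lifts to all charts, expressed through the homogeneous coordinates `(z, a, b)`, are holomorphic.
(Used for open `V`.) -/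
def ProjBundle.IsHolomorphicOn (V : Set (S.ProjBundle r)) (f : S.ProjBundle r → ℂ) : Prop :=
  ∀ i : S.ι, ∃ F : ℂ × ℂ × ℂ → ℂ,
    DifferentiableOn ℂ F {p | ∃ hp : p.1 ∈ (S.chart i).domain ∧ p.2 ≠ 0,
      ProjBundle.mk r ⟨i, p, hp⟩ ∈ V} ∧
    ∀ p, ∀ hp : p.1 ∈ (S.chart i).domain ∧ p.2 ≠ 0, ProjBundle.mk r ⟨i, p, hp⟩ ∈ V →
      F p = f (ProjBundle.mk r ⟨i, p, hp⟩)

/-- The point `x` has nontrivial isotropy group in the orbifold `ℙ(𝒪 ⊕ K_orb ^ r)`: a nontrivial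
element `g` of the group of a chart of `S` fixes the point `[a : b (dz) ^ r]` of the corresponding
chart of `ℙ(𝒪 ⊕ K_orb ^ r)`. -/
def ProjBundle.HasNontrivialIsotropy (x : S.ProjBundle r) : Prop :=
  ∃ P : S.FrameVector, ProjBundle.mk r P = x ∧ ∃ g : (S.chart P.1).G, g ≠ 1 ∧
    (S.chart P.1).act g P.2.1.1 = P.2.1.1 ∧
    ∃ c : ℂ, c ≠ 0 ∧ P.2.1.2.1 = c * P.2.1.2.1 ∧
      P.2.1.2.2 = c * (P.2.1.2.2 * deriv ((S.chart P.1).act g) P.2.1.1 ^ (-r))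

end OrbifoldRiemannSurface

/-! ### Local isomorphisms of complex spaces and Hirzebruch-Jung singularities -/

/-- The germs at `x` and `y` of two (reduced) complex spaces, given by their topologies and by
their holomorphic functions `HolX`, `HolY` on open subsets, are isomorphic: there is a
homeomorphism between open neighbourhoods which maps `x` to `y` and identifies the holomorphic
functions on all open subsets. -/
def IsGermIso {X Y : Type*} [TopologicalSpace X] [TopologicalSpace Y]
    (HolX : Set X → (X → ℂ) → Prop) (HolY : Set Y → (Y → ℂ) → Prop) (x : X) (y : Y) : Prop :=
  ∃ e : OpenPartialHomeomorph X Y, x ∈ e.source ∧ e x = y ∧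
    ∀ V ⊆ e.source, IsOpen V → ∀ f : X → ℂ, HolX V f ↔ HolY (e '' V) (f ∘ e.symm)

/-- The matrix `diag (exp (2πi / q), exp (2πi p / q))`, as an element of `U(2)`. -/
def hirzebruchJungGenerator (p q : ℕ) : Matrix.unitaryGroup (Fin 2) ℂ :=
  ⟨Matrix.diagonal ![Complex.exp (2 * Real.pi * Complex.I / q),
      Complex.exp (2 * Real.pi * Complex.I * p / q)], by
    have key : ∀ t : ℝ, Complex.exp (t * Complex.I) *
        (starRingEnd ℂ) (Complex.exp (t * Complex.I)) = 1 := fun t => by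
      rw [← Complex.exp_conj, ← Complex.exp_add]
      simp
    have h1 := key (2 * Real.pi / q)
    have h2 := key (2 * Real.pi * p / q)
    rw [show (((2 * Real.pi / q : ℝ) : ℂ) * Complex.I) = 2 * Real.pi * Complex.I / q by
      push_cast; ring] at h1
    rw [show (((2 * Real.pi * p / q : ℝ) : ℂ) * Complex.I) = 2 * Real.pi * Complex.I * p / q by
      push_cast; ring] at h2
    rw [Matrix.mem_unitaryGroup_iff, Matrix.star_eq_conjTranspose, Matrix.diagonal_conjTranspose,
      Matrix.diagonal_mul_diagonal, ← Matrix.diagonal_one]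
    congr 1
    funext i
    fin_cases i
    · simpa using h1
    · simpa using h2⟩

/-- The subgroup `Γ_{p,q}` of `U(2)` generated by `diag (exp (2πi / q), exp (2πi p / q))`. -/
def hirzebruchJungGroup (p q : ℕ) : Subgroup (Matrix.unitaryGroup (Fin 2) ℂ) :=
  Subgroup.zpowers (hirzebruchJungGenerator p q)

/-- The orbit relation of `Γ_{p,q}` on `ℂ²`. -/
def hirzebruchJungSetoid (p q : ℕ) : Setoid (Fin 2 → ℂ) where
  r z w := ∃ g ∈ hirzebruchJungGroup p q, (g : Matrix (Fin 2) (Fin 2) ℂ).mulVec z = w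
  iseqv := by
    refine ⟨fun z => ⟨1, one_mem _, by simp⟩, ?_, ?_⟩
    · rintro z _ ⟨g, hg, rfl⟩
      refine ⟨g⁻¹, inv_mem hg, ?_⟩
      rw [Matrix.mulVec_mulVec, ← Matrix.UnitaryGroup.mul_val, inv_mul_cancel]
      simp
    · rintro z _ _ ⟨g, hg, rfl⟩ ⟨k, hk, rfl⟩
      refine ⟨k * g, mul_mem hk hg, ?_⟩
      rw [Matrix.mulVec_mulVec, ← Matrix.UnitaryGroup.mul_val]

/-- The quotient space `ℂ² / Γ_{p,q}`, with the quotient topology. -/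
abbrev HirzebruchJungQuotient (p q : ℕ) : Type := Quotient (hirzebruchJungSetoid p q)

/-- Holomorphic functions on a subset of `ℂ² / Γ_{p,q}`: those whose lift to `ℂ²` is
holomorphic. (Used for open subsets.) -/
def HirzebruchJungQuotient.IsHolomorphicOn {p q : ℕ} (V : Set (HirzebruchJungQuotient p q))
    (f : HirzebruchJungQuotient p q → ℂ) : Prop :=
  DifferentiableOn ℂ (fun z => f (Quotient.mk (hirzebruchJungSetoid p q) z))
    {z | Quotient.mk (hirzebruchJungSetoid p q) z ∈ V}

namespace OrbifoldRiemannSurface.ProjBundle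

variable {X : Type u} [TopologicalSpace X] {S : OrbifoldRiemannSurface.{u, v} X} {r : ℤ}

/-- `x` is a singular point of the complex surface `ℙ(𝒪 ⊕ K_orb ^ r)`: no neighbourhood of `x` is
isomorphic to an open subset of `ℂ²`. -/
def IsSingularPoint (x : S.ProjBundle r) : Prop :=
  ¬ ∃ y : Fin 2 → ℂ, IsGermIso (ProjBundle.IsHolomorphicOn (S := S) (r := r))
    (fun (V : Set (Fin 2 → ℂ)) (f : (Fin 2 → ℂ) → ℂ) => DifferentiableOn ℂ f V) x y

/-- `x` is a singularity of type `A_{p,q}`: here `0 < p < q` are coprime, and the germ of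
`ℙ(𝒪 ⊕ K_orb ^ r)` at `x` is isomorphic to the germ of `ℂ² / Γ_{p,q}` at `0`. -/
def IsOfTypeA (p q : ℕ) (x : S.ProjBundle r) : Prop :=
  0 < p ∧ p < q ∧ p.Coprime q ∧
    IsGermIso (ProjBundle.IsHolomorphicOn (S := S) (r := r))
      (HirzebruchJungQuotient.IsHolomorphicOn (p := p) (q := q)) x
      (Quotient.mk (hirzebruchJungSetoid p q) 0)

end OrbifoldRiemannSurface.ProjBundle

end

/-!
The surface `ℙ(𝒪 ⊕ K_orb ^ r)` is analysed one fibre at a time. Near a point `x` of order `n` the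
orbifold is, in a suitable coordinate `z`, the quotient of a disc by the rotations `z ↦ ω z` with
`ω ^ n = 1`: averaging a coordinate over the stabilizer linearizes its action
(`OrbifoldChart.exists_linearization`, `exists_isLinearChart`). Since `dz` is multiplied by `ω`, the
rotation acts by `v ↦ ω ^ (-r) v` on the affine coordinate `v` of `[1 : v (dz) ^ r]`, and by
`v ↦ ω ^ r v` on that of `[v : (dz) ^ r]`. Hence the surface is covered over a neighbourhood of `x`
by the quotients of (disc) `× ℂ` by the groups of maps `(z, v) ↦ (ω z, ω ^ k v)`, with `k = -r` and
`k = r`, both as a topological space and as a space with holomorphic functions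
(`IsLinearChart.isUniformization`, `IsLinearChart.uniformizer_eq_iff`). Spaces which are quotients
of the same open set with the same fibres have isomorphic germs (`IsUniformization.isGermIso`), so
three local computations suffice.

* If `m ≡ k` modulo `n`, the quotient is the germ of `ℂ² / Γ_{m,n}` at the origin.
* At `(0, v)` with `v ≠ 0` the stabilizer consists of the reflections `(z, v) ↦ (ω z, v)`
  with `ω ^ d = 1`, `d = gcd (n, k)`, and `(z, v) ↦ (z ^ d, v)` identifies the quotient with `ℂ²`
  (`isUniformization_pow`); that holomorphic functions descend is the removable singularity
  theorem along `z = 0`. The same applies to `v = 0` if `n` divides `k`.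
* If `n` does not divide `k`, the image of the origin is singular
  (`IsUniformization.not_isGermIso`). Otherwise there would be two invariant functions
  `Φ = (Φ₁, Φ₂)` near the origin of which all invariant functions are holomorphic functions. The
  minimal invariant monomials `x ^ n`, `x ^ a s` and `s ^ m`, where `a` is the residue of `-k` and
  `m > 1` the order of `ω ^ k` for a primitive `n`-th root of unity `ω`, are then of the form
  `F_j ∘ Φ`; comparing coefficients of these three monomials shows that the differentials of
  `F₁, F₂, F₃` are biorthogonal to three vectors of `ℂ²`, which is absurd
  (`not_invariants_factor`).

So the only candidates for singular points over `x` are `[1 : 0]` and `[0 : 1]`, and they are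
singular iff `n` does not divide `r`. The two-variable function theory needed rests on the joint
continuity of the slopes of a continuous family of holomorphic functions
(`continuousAt_dslope_of_separately_holomorphic`), a consequence of the maximum principle.
-/

noncomputable section

/-! ### Germs of complex spaces uniformized by the same quotient -/

/-- `Ψ : W → X` presents an open subset of the complex space `X`, whose holomorphic functions are
given by `Hol`, as a quotient of the open set `W ⊆ ℂ²`, as a topological space and as a space with
holomorphic functions. -/
structure IsUniformization {X : Type*} [TopologicalSpace X] (Hol : Set X → (X → ℂ) → Prop)
    (W : Set (ℂ × ℂ)) (Ψ : ℂ × ℂ → X) : Prop where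
  isOpen : IsOpen W
  continuousOn : ContinuousOn Ψ W
  isOpen_image : ∀ O ⊆ W, IsOpen O → IsOpen (Ψ '' O)
  hol_iff : ∀ V ⊆ Ψ '' W, IsOpen V → ∀ f : X → ℂ,
    Hol V f ↔ DifferentiableOn ℂ (f ∘ Ψ) (W ∩ Ψ ⁻¹' V)

theorem eqOn_comp_invFunOn {X Y : Type*} {W : Set (ℂ × ℂ)} {Ψ : ℂ × ℂ → X} {Θ : ℂ × ℂ → Y}
    (hk : ∀ p ∈ W, ∀ q ∈ W, Ψ p = Ψ q → Θ p = Θ q)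
    {p : ℂ × ℂ} (hp : p ∈ W) : Θ (Function.invFunOn Ψ W (Ψ p)) = Θ p := by
  have h : ∃ a ∈ W, Ψ a = Ψ p := ⟨p, hp, rfl⟩
  exact hk _ (Function.invFunOn_mem h) _ hp (Function.invFunOn_eq h)

section

variable {X Y : Type*} [TopologicalSpace X] [TopologicalSpace Y]
  {HolX : Set X → (X → ℂ) → Prop} {HolY : Set Y → (Y → ℂ) → Prop}
  {W : Set (ℂ × ℂ)} {Ψ : ℂ × ℂ → X} {Θ : ℂ × ℂ → Y}

theorem IsUniformization.continuousOn_comp_invFunOn (hX : IsUniformization HolX W Ψ)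
    (hΘ : ContinuousOn Θ W) (hk : ∀ p ∈ W, ∀ q ∈ W, Ψ p = Ψ q → Θ p = Θ q) :
    ContinuousOn (fun x => Θ (Function.invFunOn Ψ W x)) (Ψ '' W) := by
  rw [continuousOn_open_iff (hX.isOpen_image W subset_rfl hX.isOpen)]
  intro t ht
  have : Ψ '' W ∩ (fun x => Θ (Function.invFunOn Ψ W x)) ⁻¹' t = Ψ '' (W ∩ Θ ⁻¹' t) := by
    ext x
    constructor
    · rintro ⟨⟨p, hp, rfl⟩, hx⟩
      rw [Set.mem_preimage, eqOn_comp_invFunOn hk hp] at hx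
      exact ⟨p, ⟨hp, hx⟩, rfl⟩
    · rintro ⟨p, ⟨hp, hx⟩, rfl⟩
      refine ⟨⟨p, hp, rfl⟩, ?_⟩
      rwa [Set.mem_preimage, eqOn_comp_invFunOn hk hp]
  rw [this]
  exact hX.isOpen_image _ Set.inter_subset_left (hΘ.isOpen_inter_preimage hX.isOpen ht)

/-- Two complex spaces which are uniformized by the same open set of `ℂ²`, with the same fibres,
have isomorphic germs. -/
theorem IsUniformization.isGermIso (hX : IsUniformization HolX W Ψ)
    (hY : IsUniformization HolY W Θ) (hk : ∀ p ∈ W, ∀ q ∈ W, Ψ p = Ψ q ↔ Θ p = Θ q)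
    {p : ℂ × ℂ} (hp : p ∈ W) : IsGermIso HolX HolY (Ψ p) (Θ p) := by
  have h1 : ∀ p ∈ W, Θ (Function.invFunOn Ψ W (Ψ p)) = Θ p := fun p hp =>
    eqOn_comp_invFunOn (fun p hp q hq => (hk p hp q hq).1) hp
  have h2 : ∀ p ∈ W, Ψ (Function.invFunOn Θ W (Θ p)) = Ψ p := fun p hp =>
    eqOn_comp_invFunOn (fun p hp q hq => (hk p hp q hq).2) hp
  let e : OpenPartialHomeomorph X Y :=
    { toFun := fun x => Θ (Function.invFunOn Ψ W x)
      invFun := fun y => Ψ (Function.invFunOn Θ W y)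
      source := Ψ '' W
      target := Θ '' W
      map_source' := by
        rintro _ ⟨p, hp, rfl⟩
        exact ⟨p, hp, (h1 p hp).symm⟩
      map_target' := by
        rintro _ ⟨p, hp, rfl⟩
        exact ⟨p, hp, (h2 p hp).symm⟩
      left_inv' := by
        rintro _ ⟨p, hp, rfl⟩
        rw [h1 p hp, h2 p hp]
      right_inv' := by
        rintro _ ⟨p, hp, rfl⟩
        rw [h2 p hp, h1 p hp]
      open_source := hX.isOpen_image W subset_rfl hX.isOpen
      open_target := hY.isOpen_image W subset_rfl hY.isOpen
      continuousOn_toFun := hX.continuousOn_comp_invFunOn hY.continuousOn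
        fun p hp q hq => (hk p hp q hq).1
      continuousOn_invFun := hY.continuousOn_comp_invFunOn hX.continuousOn
        fun p hp q hq => (hk p hp q hq).2 }
  have he : ∀ p ∈ W, e (Ψ p) = Θ p := h1
  have hes : ∀ p ∈ W, e.symm (Θ p) = Ψ p := h2
  refine ⟨e, ⟨p, hp, rfl⟩, he p hp, fun V hV hVo f => ?_⟩
  have hsub : e '' V ⊆ Θ '' W := by
    rintro _ ⟨x, hx, rfl⟩
    exact e.map_source (hV hx)
  rw [hX.hol_iff V hV hVo f, hY.hol_iff _ hsub (e.isOpen_image_of_subset_source hVo hV)]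
  have hset : W ∩ Θ ⁻¹' (e '' V) = W ∩ Ψ ⁻¹' V := by
    ext q
    refine and_congr_right fun hq => ?_
    simp only [Set.mem_preimage, Set.mem_image]
    constructor
    · rintro ⟨x, hx, hxq⟩
      rwa [← hes q hq, ← hxq, e.left_inv (hV hx)]
    · exact fun h => ⟨_, h, he q hq⟩
  rw [hset]
  exact differentiableOn_congr fun q hq => by simp [hes q hq.1]

end

/-! ### Holomorphic functions of several variables -/

/-- A continuous family of holomorphic functions of one variable has a jointly continuous slope,
even at the point where the slope is the derivative. -/
theorem continuousAt_dslope_of_separately_holomorphic {V : Type*} [TopologicalSpace V]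
    {f : ℂ × V → ℂ} {T : Set (ℂ × V)} (hT : IsOpen T) (hf : ContinuousOn f T)
    (hd : ∀ p ∈ T, DifferentiableAt ℂ (fun w => f (w, p.2)) p.1) {v₁ : V} (hv : (0, v₁) ∈ T) :
    ContinuousAt (fun p : ℂ × V => dslope (fun w => f (w, p.2)) 0 p.1) (0, v₁) := by
  obtain ⟨A, hA, N, hN, hAN⟩ := mem_nhds_prod_iff.1 (hT.mem_nhds hv)
  obtain ⟨R', hR', hball⟩ := Metric.mem_nhds_iff.1 hA
  obtain ⟨R, hR, hRR'⟩ := exists_between hR'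
  have hcl : Metric.closedBall (0 : ℂ) R ⊆ A := (Metric.closedBall_subset_ball hRR').trans hball
  have hv₁ : v₁ ∈ N := mem_of_mem_nhds hN
  have hdN : ∀ v ∈ N, DifferentiableOn ℂ (fun w => f (w, v)) (Metric.ball 0 R') := fun v hv w hw =>
    (hd (w, v) (hAN ⟨hball hw, hv⟩)).differentiableWithinAt
  have hdslope : ∀ v ∈ N,
      DifferentiableOn ℂ (dslope (fun w => f (w, v)) 0) (Metric.ball 0 R') := fun v hv =>
    (Complex.differentiableOn_dslope (Metric.ball_mem_nhds _ hR')).2 (hdN v hv)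
  -- On the circle of radius `R` the slopes converge uniformly as `v` tends to `v₁`.
  have hunif : ∀ ε > 0, ∀ᶠ v in 𝓝 v₁, ∀ s ∈ Metric.sphere (0 : ℂ) R,
      ‖dslope (fun w => f (w, v)) 0 s - dslope (fun w => f (w, v₁)) 0 s‖ < ε := by
    intro ε hε
    refine (isCompact_sphere (0 : ℂ) R).eventually_forall_of_forall_eventually fun s hs => ?_
    have hs0 : s ≠ 0 := ne_zero_of_mem_sphere hR.ne' ⟨s, hs⟩
    have hsT : ∀ s ∈ Metric.closedBall (0 : ℂ) R, ContinuousAt f (s, v₁) := fun s hs =>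
      hf.continuousAt (hT.mem_nhds (hAN ⟨hcl hs, hv₁⟩))
    have c1 : ContinuousAt (fun p : V × ℂ => f (p.2, p.1)) (v₁, s) :=
      ContinuousAt.comp (f := fun p : V × ℂ => (p.2, p.1))
        (hsT s (Metric.sphere_subset_closedBall hs)) (by fun_prop)
    have c2 : ContinuousAt (fun p : V × ℂ => f (0, p.1)) (v₁, s) :=
      ContinuousAt.comp (f := fun p : V × ℂ => ((0 : ℂ), p.1))
        (hsT 0 (Metric.mem_closedBall_self hR.le)) (by fun_prop)
    have c3 : ContinuousAt (fun p : V × ℂ => f (p.2, v₁)) (v₁, s) :=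
      ContinuousAt.comp (f := fun p : V × ℂ => (p.2, v₁))
        (hsT s (Metric.sphere_subset_closedBall hs)) (by fun_prop)
    have c : ContinuousAt (fun p : V × ℂ => ‖p.2⁻¹ * (f (p.2, p.1) - f (0, p.1)) -
        p.2⁻¹ * (f (p.2, v₁) - f (0, v₁))‖) (v₁, s) := by
      have := (continuousAt_snd (X := V) (p := (v₁, s))).inv₀ hs0
      exact ((this.mul (c1.sub c2)).sub (this.mul (c3.sub continuousAt_const))).norm
    have hlt := c.eventually_lt (continuousAt_const (y := ε)) (by simpa using hε)
    filter_upwards [hlt, (continuousAt_snd (X := V) (p := (v₁, s))).eventually_ne hs0] with p hp hp0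
    simpa [dslope_of_ne _ hp0, slope_def_module] using hp
  have hmax : ∀ ε > 0, ∀ᶠ v in 𝓝 v₁, ∀ w ∈ Metric.ball (0 : ℂ) R,
      ‖dslope (fun w => f (w, v)) 0 w - dslope (fun w => f (w, v₁)) 0 w‖ ≤ ε := by
    intro ε hε
    filter_upwards [hunif ε hε, hN] with v hv hvN w hw
    refine Complex.norm_le_of_forall_mem_frontier_norm_le (U := Metric.ball (0 : ℂ) R)
      (f := fun w => dslope (fun w => f (w, v)) 0 w - dslope (fun w => f (w, v₁)) 0 w)
      Metric.isBounded_ball ?_ ?_ (subset_closure hw)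
    · refine DifferentiableOn.diffContOnCl ?_
      rw [closure_ball _ hR.ne']
      exact ((hdslope v hvN).sub (hdslope v₁ hv₁)).mono (Metric.closedBall_subset_ball hRR')
    · rw [frontier_ball _ hR.ne']
      exact fun s hs => (hv s hs).le
  have h0 : ContinuousAt (dslope (fun w => f (w, v₁)) 0) 0 :=
    ((hdslope v₁ hv₁).differentiableAt (Metric.ball_mem_nhds _ hR')).continuousAt
  rw [Metric.continuousAt_iff']
  intro ε hε
  rw [nhds_prod_eq]
  have e1 := (hmax (ε / 2) (half_pos hε)).prod_inr (𝓝 (0 : ℂ))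
  have e2 := ((Metric.continuousAt_iff'.1 h0 (ε / 2) (half_pos hε)).and
    (Metric.ball_mem_nhds (0 : ℂ) hR)).prod_inl (𝓝 v₁)
  filter_upwards [e1, e2] with p h1 h2
  have := h1 p.1 h2.2
  rw [← dist_eq_norm] at this
  linarith [dist_triangle (dslope (fun w => f (w, p.2)) 0 p.1) (dslope (fun w => f (w, v₁)) 0 p.1)
    (dslope (fun w => f (w, v₁)) 0 0), h2.1]

/-- The directional derivatives of a holomorphic function are continuous. -/
theorem DifferentiableOn.continuousAt_fderiv_apply {E : Type*} [NormedAddCommGroup E]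
    [NormedSpace ℂ E] {F : E → ℂ} {T : Set E} (hF : DifferentiableOn ℂ F T) (hT : IsOpen T)
    {y : E} (hy : y ∈ T) (v : E) : ContinuousAt (fun z => fderiv ℂ F z v) y := by
  have hc : Continuous fun p : ℂ × E => p.2 + p.1 • v := by fun_prop
  have hd : ∀ p ∈ (fun p : ℂ × E => p.2 + p.1 • v) ⁻¹' T,
      HasDerivAt (fun w => F (p.2 + w • v)) (fderiv ℂ F (p.2 + p.1 • v) v) p.1 := fun p hp => by
    have h1 := (hF.differentiableAt (hT.mem_nhds hp)).hasFDerivAt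
    have h2 : HasDerivAt (fun w : ℂ => p.2 + w • v) v p.1 := by
      simpa using ((hasDerivAt_id p.1).smul_const v).const_add p.2
    exact h1.comp_hasDerivAt p.1 h2
  have h := continuousAt_dslope_of_separately_holomorphic (f := fun p : ℂ × E => F (p.2 + p.1 • v))
    (v₁ := y) (hT.preimage hc) (hF.continuousOn.comp hc.continuousOn fun p hp => hp)
    (fun p hp => (hd p hp).differentiableAt) (by simpa using hy)
  have h2 : ContinuousAt (fun z : E =>
      dslope (fun w : ℂ => F (z + w • v)) 0 0) y :=
    ContinuousAt.comp (f := fun z : E => ((0 : ℂ), z)) h (by fun_prop)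
  refine h2.congr ?_
  filter_upwards [hT.mem_nhds hy] with z hz
  rw [dslope_same, (hd (0, z) (by simpa using hz)).deriv]
  simp

/-- The partial derivative of a holomorphic function of two variables in the second variable is
holomorphic in the first variable. -/
theorem analyticAt_deriv_snd {Φ : ℂ × ℂ → ℂ} {T : Set (ℂ × ℂ)}
    (hΦ : DifferentiableOn ℂ Φ T) (hT : IsOpen T) {x : ℂ} (hx : (x, 0) ∈ T) :
    AnalyticAt ℂ (fun x => deriv (fun s => Φ (x, s)) 0) x := by
  have hc : Continuous fun x : ℂ => (x, (0 : ℂ)) := by fun_prop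
  have hU : IsOpen {x : ℂ | (x, (0 : ℂ)) ∈ T} := hT.preimage hc
  have hsw : Continuous (Prod.swap : ℂ × ℂ → ℂ × ℂ) := continuous_swap
  have hD : ∀ x : ℂ, (x, 0) ∈ T →
      ContinuousAt (fun p : ℂ × ℂ => dslope (fun s => Φ (p.2, s)) 0 p.1) (0, x) := fun x hx =>
    continuousAt_dslope_of_separately_holomorphic (f := Φ ∘ Prod.swap) (hT.preimage hsw)
      (hΦ.continuousOn.comp hsw.continuousOn fun p hp => hp)
      (fun p hp => by
        have h1 : DifferentiableAt ℂ Φ (p.2, p.1) := hΦ.differentiableAt (hT.mem_nhds hp)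
        exact DifferentiableAt.comp (f := fun s : ℂ => (p.2, s)) p.1 h1 (by fun_prop)) hx
  suffices h : DifferentiableOn ℂ (fun x => deriv (fun s => Φ (x, s)) 0) {x : ℂ | (x, (0 : ℂ)) ∈ T}
    from h.analyticAt (hU.mem_nhds hx)
  intro x hx
  obtain ⟨A, hA, B, hB, hAB⟩ := mem_nhds_prod_iff.1 (hT.mem_nhds hx)
  obtain ⟨B', hB'B, hB'o, hxB'⟩ := mem_nhds_iff.1 hA
  suffices h : DifferentiableOn ℂ (fun x => deriv (fun s => Φ (x, s)) 0) B' from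
    (h.differentiableAt (hB'o.mem_nhds hxB')).differentiableWithinAt
  have h0B : (0 : ℂ) ∈ B := mem_of_mem_nhds hB
  have hlim : TendstoLocallyUniformlyOn (fun (s : ℂ) x => dslope (fun s => Φ (x, s)) 0 s)
      (fun x => deriv (fun s => Φ (x, s)) 0) (𝓝[≠] 0) B' := by
    rw [Metric.tendstoLocallyUniformlyOn_iff]
    intro ε hε x hx
    have hcx := hD x (hAB ⟨hB'B hx, h0B⟩)
    have h1 := Metric.continuousAt_iff'.1 hcx (ε / 2) (half_pos hε)
    rw [nhds_prod_eq, eventually_prod_iff] at h1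
    obtain ⟨p, hp, q, hq, hpq⟩ := h1
    refine ⟨_, mem_nhdsWithin_of_mem_nhds hq, (hp.filter_mono nhdsWithin_le_nhds).mono ?_⟩
    intro s hs z hz
    have h2 := hpq hs hz
    have h3 := hpq hp.self_of_nhds hz
    simp only [dslope_same] at h2 h3 ⊢
    calc _ ≤ _ := dist_triangle_right _ _ _
      _ < ε := by linarith
  refine hlim.differentiableOn ?_ hB'o
  filter_upwards [mem_nhdsWithin_of_mem_nhds hB, self_mem_nhdsWithin] with s hs hs0 z hz
  have hz1 : DifferentiableAt ℂ Φ (z, s) :=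
    hΦ.differentiableAt (hT.mem_nhds (hAB ⟨hB'B hz, hs⟩))
  have hz2 : DifferentiableAt ℂ Φ (z, 0) :=
    hΦ.differentiableAt (hT.mem_nhds (hAB ⟨hB'B hz, h0B⟩))
  have d1 : DifferentiableAt ℂ (fun z => Φ (z, s)) z :=
    DifferentiableAt.comp (f := fun z : ℂ => (z, s)) z hz1 (by fun_prop)
  have d2 : DifferentiableAt ℂ (fun z => Φ (z, 0)) z :=
    DifferentiableAt.comp (f := fun z : ℂ => (z, (0 : ℂ))) z hz2 (by fun_prop)
  simp only [dslope_of_ne _ hs0, slope_def_module]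
  exact ((d1.sub d2).const_smul (s - 0)⁻¹).differentiableWithinAt

/-- A continuous function of two variables which is holomorphic in the first variable, and whose
restriction to the axis `w = 0` is holomorphic, is jointly differentiable at the points of that
axis. -/
theorem differentiableAt_of_separately_holomorphic {f : ℂ × ℂ → ℂ} {T : Set (ℂ × ℂ)}
    (hT : IsOpen T) (hf : ContinuousOn f T)
    (hd : ∀ p ∈ T, DifferentiableAt ℂ (fun w => f (w, p.2)) p.1) {v₁ : ℂ} (hv : (0, v₁) ∈ T)
    (h0 : DifferentiableAt ℂ (fun v => f (0, v)) v₁) : DifferentiableAt ℂ f (0, v₁) := by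
  have hc := continuousAt_dslope_of_separately_holomorphic hT hf hd hv
  set D : ℂ × ℂ → ℂ := fun p => dslope (fun w => f (w, p.2)) 0 p.1 with hD
  have hfD : f = fun p => f (0, p.2) + p.1 * D p := by
    funext p
    have := sub_smul_dslope (fun w => f (w, p.2)) 0 p.1
    simp only [sub_zero, smul_eq_mul] at this
    simp [hD, this]
  have h1 : HasFDerivAt (fun p : ℂ × ℂ => p.1 * D p)
      (D (0, v₁) • ContinuousLinearMap.fst ℂ ℂ ℂ) (0, v₁) := by
    rw [hasFDerivAt_iff_isLittleO]
    have hb : (fun p : ℂ × ℂ => p.1) =O[𝓝 (0, v₁)] fun p => ‖p - (0, v₁)‖ :=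
      Asymptotics.IsBigO.of_bound 1 (Eventually.of_forall fun p => by
        simpa using norm_fst_le (p - ((0 : ℂ), v₁)))
    have hl : (fun p : ℂ × ℂ => D p - D (0, v₁)) =o[𝓝 (0, v₁)] fun _ => (1 : ℝ) := by
      rw [Asymptotics.isLittleO_one_iff]
      simpa using hc.tendsto.sub_const (D (0, v₁))
    refine (((hb.mul_isLittleO hl).congr_right fun p => mul_one _).congr_left
      fun p => ?_).of_norm_right
    simp
    ring
  rw [hfD]
  have h2 : DifferentiableAt ℂ (fun p : ℂ × ℂ => f (0, p.2)) (0, v₁) :=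
    DifferentiableAt.comp (f := fun p : ℂ × ℂ => p.2) (g := fun v => f (0, v)) (0, v₁) h0
      differentiableAt_snd
  exact h2.add h1.differentiableAt

/-! ### The quotient of `ℂ²` by a group of reflections -/

theorem isOpenMap_pow_prodMap {d : ℕ} (hd : d ≠ 0) :
    IsOpenMap fun p : ℂ × ℂ => (p.1 ^ d, p.2) := by
  have : NeZero d := ⟨hd⟩
  exact (Complex.isOpenQuotientMap_pow d).isOpenMap.prodMap IsOpenMap.id

/-- A function of `(w, v)` is holomorphic as soon as it is holomorphic as a function of `(ζ, v)`,
where `w = ζ ^ d`. Away from `w = 0` a local `d`-th root is available; on `w = 0` the singularity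
is removable. -/
theorem differentiableOn_of_comp_pow {d : ℕ} (hd : d ≠ 0) {W V : Set (ℂ × ℂ)} (hW : IsOpen W)
    (hV : IsOpen V) (hVW : V ⊆ (fun p : ℂ × ℂ => (p.1 ^ d, p.2)) '' W) {f : ℂ × ℂ → ℂ}
    (hf : DifferentiableOn ℂ (fun p : ℂ × ℂ => f (p.1 ^ d, p.2))
      (W ∩ (fun p : ℂ × ℂ => (p.1 ^ d, p.2)) ⁻¹' V)) : DifferentiableOn ℂ f V := by
  have hΘ : Continuous fun p : ℂ × ℂ => (p.1 ^ d, p.2) := by fun_prop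
  have hW' : IsOpen (W ∩ (fun p : ℂ × ℂ => (p.1 ^ d, p.2)) ⁻¹' V) := hW.inter (hV.preimage hΘ)
  have hroot : ∀ y ∈ V, y.1 ≠ 0 → DifferentiableAt ℂ f y := by
    intro y hy hy0
    obtain ⟨p, hp, rfl⟩ := hVW hy
    have hp0 : p.1 ≠ 0 := fun h => hy0 (by simp [h, hd])
    have hs : HasStrictDerivAt (fun z : ℂ => z ^ d) (d * p.1 ^ (d - 1)) p.1 :=
      hasStrictDerivAt_pow d p.1
    have hne : (d * p.1 ^ (d - 1) : ℂ) ≠ 0 :=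
      mul_ne_zero (Nat.cast_ne_zero.2 hd) (pow_ne_zero _ hp0)
    let ρ := hs.localInverse _ _ _ hne
    have hρ : DifferentiableAt ℂ ρ (p.1 ^ d) := (hs.to_localInverse hne).hasDerivAt.differentiableAt
    have hρp : ρ (p.1 ^ d) = p.1 := HasStrictFDerivAt.localInverse_apply_image ..
    have hr : ∀ᶠ t in 𝓝 (p.1 ^ d), ρ t ^ d = t := HasStrictDerivAt.eventually_right_inverse ..
    have hτ : DifferentiableAt ℂ (fun y : ℂ × ℂ => (ρ y.1, y.2)) (p.1 ^ d, p.2) :=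
      (DifferentiableAt.comp (f := fun y : ℂ × ℂ => y.1) (p.1 ^ d, p.2) hρ
        differentiableAt_fst).prodMk differentiableAt_snd
    have hg : DifferentiableAt ℂ (fun p : ℂ × ℂ => f (p.1 ^ d, p.2)) (ρ (p.1 ^ d), p.2) := by
      rw [hρp]
      exact hf.differentiableAt (hW'.mem_nhds ⟨hp, hy⟩)
    refine (DifferentiableAt.comp (f := fun y : ℂ × ℂ => (ρ y.1, y.2)) (p.1 ^ d, p.2) hg
      hτ).congr_of_eventuallyEq ?_
    have : ∀ᶠ y : ℂ × ℂ in 𝓝 (p.1 ^ d, p.2), ρ y.1 ^ d = y.1 :=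
      (continuousAt_fst (X := ℂ) (Y := ℂ) (p := (p.1 ^ d, p.2))).eventually hr
    filter_upwards [this] with y hy
    simp [hy]
  have hcont : ContinuousOn f V := by
    rw [continuousOn_open_iff hV]
    intro t ht
    have : V ∩ f ⁻¹' t = (fun p : ℂ × ℂ => (p.1 ^ d, p.2)) ''
        ((W ∩ (fun p : ℂ × ℂ => (p.1 ^ d, p.2)) ⁻¹' V) ∩
          (fun p : ℂ × ℂ => f (p.1 ^ d, p.2)) ⁻¹' t) := by
      ext y
      constructor
      · rintro ⟨hy, hyt⟩
        obtain ⟨p, hp, rfl⟩ := hVW hy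
        exact ⟨p, ⟨⟨hp, hy⟩, hyt⟩, rfl⟩
      · rintro ⟨p, ⟨⟨hp, hy⟩, hyt⟩, rfl⟩
        exact ⟨hy, hyt⟩
    rw [this]
    exact isOpenMap_pow_prodMap hd _ (hf.continuousOn.isOpen_inter_preimage hW' ht)
  rintro ⟨w, v⟩ hy
  refine DifferentiableAt.differentiableWithinAt ?_
  by_cases hw : w = 0
  · subst hw
    refine differentiableAt_of_separately_holomorphic hV hcont ?_ hy ?_
    · rintro ⟨w, v⟩ hp
      by_cases hw : w = 0
      · subst hw
        have hopen : IsOpen {w : ℂ | (w, v) ∈ V} :=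
          hV.preimage (f := fun w : ℂ => (w, v)) (by fun_prop)
        refine (Complex.analyticAt_of_differentiable_on_punctured_nhds_of_continuousAt ?_
          ?_).differentiableAt
        · filter_upwards [mem_nhdsWithin_of_mem_nhds (hopen.mem_nhds hp), self_mem_nhdsWithin]
            with z hz hz0
          exact DifferentiableAt.comp (f := fun w : ℂ => (w, v)) z (hroot _ hz hz0) (by fun_prop)
        · exact ContinuousAt.comp (f := fun w : ℂ => (w, v)) (hcont.continuousAt (hV.mem_nhds hp))
            (by fun_prop)
      · exact DifferentiableAt.comp (f := fun w : ℂ => (w, v)) w (hroot _ hp hw) (by fun_prop)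
    · obtain ⟨p, hp, hpy⟩ := hVW hy
      have hp0 : p = (0, v) := by
        have h1 : p.1 ^ d = 0 := congrArg Prod.fst hpy
        have h2 : p.2 = v := congrArg Prod.snd hpy
        exact Prod.ext (by simpa [hd] using h1) h2
      have hg : DifferentiableAt ℂ (fun p : ℂ × ℂ => f (p.1 ^ d, p.2)) (0, v) :=
        hf.differentiableAt (hW'.mem_nhds ⟨hp0 ▸ hp, by simpa [hd] using hy⟩)
      have := DifferentiableAt.comp (f := fun v : ℂ => ((0 : ℂ), v)) v hg (by fun_prop)
      simpa [Function.comp_def, hd] using this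
  · exact hroot _ hy hw

/-- The map `(ζ, v) ↦ (ζ ^ d, v)` presents `ℂ²` as the quotient of `ℂ²` by a group of
reflections. -/
theorem isUniformization_pow {d : ℕ} (hd : d ≠ 0) {W : Set (ℂ × ℂ)} (hW : IsOpen W) :
    IsUniformization (fun (V : Set (Fin 2 → ℂ)) (f : (Fin 2 → ℂ) → ℂ) => DifferentiableOn ℂ f V)
      W (fun p => (ContinuousLinearEquiv.finTwoArrow ℂ ℂ).symm (p.1 ^ d, p.2)) where
  isOpen := hW
  continuousOn := by
    refine Continuous.continuousOn ?_
    exact (ContinuousLinearEquiv.finTwoArrow ℂ ℂ).symm.continuous.comp (by fun_prop)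
  isOpen_image O _ hO := by
    have := (ContinuousLinearEquiv.finTwoArrow ℂ ℂ).symm.toHomeomorph.isOpenMap _
      (isOpenMap_pow_prodMap hd O hO)
    rwa [Set.image_image] at this
  hol_iff V hV hVo f := by
    set α := (ContinuousLinearEquiv.finTwoArrow ℂ ℂ).symm
    constructor
    · intro h
      refine h.comp (Differentiable.differentiableOn ?_) fun p hp => hp.2
      exact α.differentiable.comp (by fun_prop)
    · intro h
      have h1 : DifferentiableOn ℂ (f ∘ α) (α ⁻¹' V) := by
        refine differentiableOn_of_comp_pow hd hW (hVo.preimage α.continuous) ?_ h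
        intro y hy
        obtain ⟨p, hp, hpy⟩ := hV hy
        exact ⟨p, hp, α.injective hpy⟩
      have h2 := h1.comp (s := V) α.symm.differentiable.differentiableOn
        fun y hy => by simpa using hy
      simpa [Function.comp_def] using h2

/-! ### The quotient of `ℂ²` by `Γ_{p,q}` -/

theorem hirzebruchJungGenerator_mulVec (p q : ℕ) (a b : ℂ) :
    (hirzebruchJungGenerator p q : Matrix (Fin 2) (Fin 2) ℂ).mulVec ![a, b] =
    ![Complex.exp (2 * Real.pi * Complex.I / q) * a,
      Complex.exp (2 * Real.pi * Complex.I / q) ^ p * b] := by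
  have h : Complex.exp (2 * Real.pi * Complex.I * p / q) =
      Complex.exp (2 * Real.pi * Complex.I / q) ^ p := by
    rw [← Complex.exp_nat_mul]
    congr 1
    ring
  ext i
  fin_cases i <;> simp [hirzebruchJungGenerator, Matrix.mulVec_diagonal, h]

theorem hirzebruchJungGenerator_zpow_mulVec (p q : ℕ) (k : ℤ) (a b : ℂ) :
    ((hirzebruchJungGenerator p q ^ k : Matrix.unitaryGroup (Fin 2) ℂ) :
      Matrix (Fin 2) (Fin 2) ℂ).mulVec ![a, b] =
    ![Complex.exp (2 * Real.pi * Complex.I / q) ^ k * a,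
      (Complex.exp (2 * Real.pi * Complex.I / q) ^ k) ^ p * b] := by
  set ω := Complex.exp (2 * Real.pi * Complex.I / q)
  have hω : ω ≠ 0 := Complex.exp_ne_zero _
  have hinv : ∀ a b : ℂ, ((hirzebruchJungGenerator p q)⁻¹ :
      Matrix.unitaryGroup (Fin 2) ℂ).1.mulVec ![a, b] = ![ω⁻¹ * a, (ω⁻¹) ^ p * b] := by
    intro a b
    have h := hirzebruchJungGenerator_mulVec p q (ω⁻¹ * a) ((ω⁻¹) ^ p * b)
    rw [mul_inv_cancel_left₀ hω, ← mul_assoc, ← mul_pow, mul_inv_cancel₀ hω, one_pow,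
      one_mul] at h
    rw [← h, Matrix.mulVec_mulVec, ← Matrix.UnitaryGroup.mul_val, inv_mul_cancel]
    simp
  induction k generalizing a b with
  | zero => simp
  | succ k ih =>
    rw [zpow_add_one, Matrix.UnitaryGroup.mul_val, ← Matrix.mulVec_mulVec,
      hirzebruchJungGenerator_mulVec, ih, zpow_add_one₀ hω, mul_pow, mul_assoc (ω ^ (k : ℤ)),
      mul_assoc ((ω ^ (k : ℤ)) ^ p)]
  | pred k ih =>
    rw [zpow_sub_one, Matrix.UnitaryGroup.mul_val, ← Matrix.mulVec_mulVec, hinv, ih,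
      zpow_sub_one₀ hω, mul_pow, mul_assoc, mul_assoc]

/-- Two points of `ℂ²` have the same image in `ℂ² / Γ_{p,q}` iff they differ by the action
`λ • (a, b) = (λ a, λ ^ p b)` of a `q`-th root of unity. -/
theorem hirzebruchJung_mk_eq_iff {p q : ℕ} (hq : q ≠ 0) {a b a' b' : ℂ} :
    Quotient.mk (hirzebruchJungSetoid p q) ![a, b] =
      Quotient.mk (hirzebruchJungSetoid p q) ![a', b'] ↔
    ∃ c : ℂ, c ^ q = 1 ∧ a' = c * a ∧ b' = c ^ p * b := by
  rw [Quotient.eq]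
  have hprim : IsPrimitiveRoot (Complex.exp (2 * Real.pi * Complex.I / q)) q :=
    Complex.isPrimitiveRoot_exp q hq
  constructor
  · rintro ⟨g, hg, h⟩
    obtain ⟨k, rfl⟩ := Subgroup.mem_zpowers_iff.1 hg
    rw [hirzebruchJungGenerator_zpow_mulVec] at h
    refine ⟨Complex.exp (2 * Real.pi * Complex.I / q) ^ k, ?_, (congrFun h 0).symm,
      (congrFun h 1).symm⟩
    rw [← zpow_natCast, zpow_comm, zpow_natCast, hprim.pow_eq_one, one_zpow]
  · rintro ⟨c, hc, rfl, rfl⟩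
    have : NeZero q := ⟨hq⟩
    obtain ⟨i, -, rfl⟩ := hprim.eq_pow_of_pow_eq_one hc
    refine ⟨hirzebruchJungGenerator p q ^ (i : ℤ), Subgroup.mem_zpowers_iff.2 ⟨i, rfl⟩, ?_⟩
    rw [hirzebruchJungGenerator_zpow_mulVec, zpow_natCast]

/-- The quotient map `ℂ² → ℂ² / Γ_{p,q}`, in the coordinates `(ζ, v)`. -/
def hirzebruchJungMk (p q : ℕ) (z : ℂ × ℂ) : HirzebruchJungQuotient p q :=
  Quotient.mk (hirzebruchJungSetoid p q) ![z.1, z.2]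

theorem isOpenMap_hirzebruchJungMk {p q : ℕ} (hq : q ≠ 0) : IsOpenMap (hirzebruchJungMk p q) := by
  intro O hO
  rw [← isQuotientMap_quotient_mk'.isOpen_preimage]
  have : (Quotient.mk (hirzebruchJungSetoid p q)) ⁻¹' (hirzebruchJungMk p q '' O) =
      ⋃ c ∈ {c : ℂ | c ^ q = 1}, (fun z : Fin 2 → ℂ => (c * z 0, c ^ p * z 1)) ⁻¹' O := by
    ext z
    have hz : z = ![z 0, z 1] := by ext i; fin_cases i <;> rfl
    simp only [Set.mem_preimage, Set.mem_image, Set.mem_iUnion, Set.mem_ofPred_eq, exists_prop]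
    constructor
    · rintro ⟨w, hw, h⟩
      rw [hz] at h
      obtain ⟨c, hc, h1, h2⟩ := (hirzebruchJung_mk_eq_iff hq).1 h.symm
      exact ⟨c, hc, by rwa [← h1, ← h2]⟩
    · rintro ⟨c, hc, h⟩
      refine ⟨_, h, ?_⟩
      conv_rhs => rw [hz]
      exact ((hirzebruchJung_mk_eq_iff hq).2 ⟨c, hc, rfl, rfl⟩).symm
  refine this ▸ isOpen_biUnion fun c _ => hO.preimage (by fun_prop)

theorem isUniformization_hirzebruchJungMk {p q : ℕ} (hq : q ≠ 0) {W : Set (ℂ × ℂ)}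
    (hW : IsOpen W) (hinv : ∀ z ∈ W, ∀ c : ℂ, c ^ q = 1 → (c * z.1, c ^ p * z.2) ∈ W) :
    IsUniformization (HirzebruchJungQuotient.IsHolomorphicOn (p := p) (q := q)) W
      (hirzebruchJungMk p q) where
  isOpen := hW
  continuousOn := by
    refine Continuous.continuousOn (continuous_quotient_mk'.comp ?_)
    exact (ContinuousLinearEquiv.finTwoArrow ℂ ℂ).symm.continuous
  isOpen_image O _ hO := isOpenMap_hirzebruchJungMk hq O hO
  hol_iff V hV hVo f := by
    set α := (ContinuousLinearEquiv.finTwoArrow ℂ ℂ).symm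
    have hα : ∀ z, hirzebruchJungMk p q z = Quotient.mk (hirzebruchJungSetoid p q) (α z) :=
      fun z => rfl
    have hVW : hirzebruchJungMk p q ⁻¹' V ⊆ W := by
      intro z hz
      obtain ⟨w, hw, h⟩ := hV hz
      obtain ⟨c, hc, h1, h2⟩ := (hirzebruchJung_mk_eq_iff hq).1 h
      have := hinv w hw c hc
      rwa [← h1, ← h2] at this
    rw [Set.inter_eq_right.2 hVW, HirzebruchJungQuotient.IsHolomorphicOn]
    constructor
    · intro h
      exact h.comp (s := hirzebruchJungMk p q ⁻¹' V) α.differentiable.differentiableOn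
        fun z hz => hz
    · intro h
      have hmap : Set.MapsTo α.symm {z | Quotient.mk (hirzebruchJungSetoid p q) z ∈ V}
          (hirzebruchJungMk p q ⁻¹' V) := fun z hz => by
        rw [Set.mem_preimage, hα, α.apply_symm_apply]
        exact hz
      refine (h.comp α.symm.differentiable.differentiableOn hmap).congr fun z _ => ?_
      simp [hα]

/-! ### Quotients of `ℂ²` by cyclic groups without linear invariants are singular -/

/-- If `g` vanishes at `0` and is homogeneous of weight `c`, where `c ≤ n`, for the action of the
`n`-th roots of unity, then `g` is divisible by `x ^ c`. -/
theorem exists_tendsto_of_homogeneous {g : ℂ → ℂ} (hg : AnalyticAt ℂ g 0) (hg0 : g 0 = 0) {n c : ℕ}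
    {ω : ℂ} (hω : IsPrimitiveRoot ω n) (hcn : c ≤ n)
    (hinv : ∀ᶠ x in 𝓝 0, g (ω * x) = ω ^ c * g x) :
    ∃ β, Tendsto (fun x => (x ^ c)⁻¹ * g x) (𝓝[≠] 0) (𝓝 β) := by
  by_cases h0 : ∀ᶠ x in 𝓝 0, g x = 0
  · refine ⟨0, (tendsto_congr' ?_).2 tendsto_const_nhds⟩
    filter_upwards [h0.filter_mono nhdsWithin_le_nhds] with x hx
    simp [hx]
  obtain ⟨N, k, hk, hk0, hgk⟩ := hg.exists_eventuallyEq_pow_smul_nonzero_iff.2 h0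
  simp only [sub_zero, smul_eq_mul] at hgk
  have hN : N ≠ 0 := by
    rintro rfl
    have := hgk.self_of_nhds
    simp only [pow_zero, one_mul] at this
    exact hk0 (this ▸ hg0)
  have hωc : Tendsto (fun x : ℂ => ω * x) (𝓝 0) (𝓝 0) := by
    have : Continuous fun x : ℂ => ω * x := by fun_prop
    simpa using this.tendsto 0
  have hpow : ω ^ N = ω ^ c := by
    have h1 : Tendsto (fun x => ω ^ N * k (ω * x)) (𝓝[≠] 0) (𝓝 (ω ^ N * k 0)) :=
      ((hk.continuousAt.tendsto.comp hωc).const_mul _).mono_left nhdsWithin_le_nhds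
    have h2 : Tendsto (fun x => ω ^ c * k x) (𝓝[≠] 0) (𝓝 (ω ^ c * k 0)) :=
      (hk.continuousAt.tendsto.const_mul _).mono_left nhdsWithin_le_nhds
    refine mul_right_cancel₀ hk0 (tendsto_nhds_unique (h1.congr' ?_) h2)
    filter_upwards [hgk.filter_mono nhdsWithin_le_nhds, hinv.filter_mono nhdsWithin_le_nhds,
      (hωc.eventually hgk).filter_mono nhdsWithin_le_nhds, self_mem_nhdsWithin] with x h1 h2 h3 hx
    refine mul_left_cancel₀ (pow_ne_zero N hx) ?_
    rw [h1, h3] at h2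
    rw [mul_pow] at h2
    linear_combination h2
  have hcN : c ≤ N := by
    by_contra! hlt
    have h1 : ω ^ (c - N) = 1 := by
      refine mul_left_cancel₀ (pow_ne_zero N (hω.ne_zero (by lia))) ?_
      rw [← pow_add, Nat.add_sub_cancel' hlt.le, mul_one, hpow]
    have hd := hω.dvd_of_pow_eq_one _ h1
    have := Nat.le_of_dvd (by lia) hd
    lia
  refine ⟨0 ^ (N - c) * k 0, ?_⟩
  have h1 : Tendsto (fun x => x ^ (N - c) * k x) (𝓝[≠] 0) (𝓝 (0 ^ (N - c) * k 0)) :=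
    (((continuous_pow (N - c)).tendsto 0).mul hk.continuousAt.tendsto).mono_left nhdsWithin_le_nhds
  refine h1.congr' ?_
  filter_upwards [hgk.filter_mono nhdsWithin_le_nhds, self_mem_nhdsWithin] with x h1 hx
  rw [h1, ← Nat.sub_add_cancel hcN, Nat.add_sub_cancel, pow_add]
  field_simp [pow_ne_zero c hx]

/-- There are at most two biorthogonal pairs of vectors and functionals in `ℂ²`. -/
theorem not_biorthogonal_three (L₁ L₂ L₃ : (Fin 2 → ℂ) →L[ℂ] ℂ) (a b c : Fin 2 → ℂ)
    (h₁ : L₁ a = 1 ∧ L₁ b = 0 ∧ L₁ c = 0) (h₂ : L₂ a = 0 ∧ L₂ b = 1 ∧ L₂ c = 0)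
    (h₃ : L₃ a = 0 ∧ L₃ b = 0 ∧ L₃ c = 1) : False := by
  let L : (Fin 2 → ℂ) →ₗ[ℂ] (Fin 3 → ℂ) := LinearMap.pi ![L₁.toLinearMap, L₂.toLinearMap,
    L₃.toLinearMap]
  have hL : Function.Surjective L := fun t => by
    refine ⟨t 0 • a + t 1 • b + t 2 • c, ?_⟩
    ext i
    fin_cases i <;> simp [L, h₁, h₂, h₃]
  have := LinearMap.finrank_le_finrank_of_surjective hL
  simp at this

/-- The obstruction to smoothness: if the coordinates of `Φ : ℂ² → ℂ²` are invariant under the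
cyclic group generated by `(x, s) ↦ (ω x, ω ^ k s)`, where `ω ^ k ≠ 1`, then the three minimal
invariant monomials `x ^ n`, `x ^ a s` and `s ^ m` are not all holomorphic functions of `Φ`. The
leading coefficients of `Φ` along `x ^ n`, `x ^ a s` and `s ^ m` would be biorthogonal to the
differentials of these three functions. -/
theorem not_invariants_factor {D : Set (ℂ × ℂ)} (hD : IsOpen D) (h0D : (0, 0) ∈ D)
    {Φ : ℂ × ℂ → Fin 2 → ℂ} (hΦ : DifferentiableOn ℂ Φ D) {n a : ℕ} (ha : a ≠ 0) (han : a < n)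
    {k : ℤ} {ω : ℂ} (hω : IsPrimitiveRoot ω n) (hka : ω ^ k * ω ^ a = 1)
    (hinv : ∀ z ∈ D, (ω * z.1, ω ^ k * z.2) ∈ D → Φ (ω * z.1, ω ^ k * z.2) = Φ z)
    {T : Set (Fin 2 → ℂ)} (hT : IsOpen T) (hDT : Set.MapsTo Φ D T) {F₁ F₂ F₃ : (Fin 2 → ℂ) → ℂ}
    (hF₁ : DifferentiableOn ℂ F₁ T) (hF₂ : DifferentiableOn ℂ F₂ T)
    (hF₃ : DifferentiableOn ℂ F₃ T) (h₁ : ∀ z ∈ D, F₁ (Φ z) = z.1 ^ n)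
    (h₂ : ∀ z ∈ D, F₂ (Φ z) = z.1 ^ a * z.2)
    (h₃ : ∀ z ∈ D, F₃ (Φ z) = z.2 ^ orderOf (ω ^ k)) : False := by
  have hn : n ≠ 0 := by lia
  have hω0 : ω ≠ 0 := hω.ne_zero hn
  set μ := ω ^ k with hμ
  set m := orderOf μ with hm
  have hμprim : IsPrimitiveRoot μ m := IsPrimitiveRoot.orderOf μ
  have hμn : μ ^ n = 1 := by
    rw [hμ, ← zpow_natCast, zpow_comm, zpow_natCast, hω.pow_eq_one, one_zpow]
  have hμ1 : μ ≠ 1 := by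
    intro h
    rw [h, one_mul] at hka
    exact hω.pow_ne_one_of_pos_of_lt ha han hka
  have hm0 : m ≠ 0 := (orderOf_pos_iff.2 (isOfFinOrder_iff_pow_eq_one.2 ⟨n, by lia, hμn⟩)).ne'
  have hm1 : m ≠ 1 := fun h => hμ1 (orderOf_eq_one_iff.1 h)
  have hDn : D ∈ 𝓝 (0, 0) := hD.mem_nhds h0D
  -- The two axes, and their images under the generator, are near the origin in `D`.
  have hx : ∀ᶠ x : ℂ in 𝓝 0, (x, (0 : ℂ)) ∈ D := by
    have : Continuous fun x : ℂ => (x, (0 : ℂ)) := by fun_prop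
    exact this.continuousAt.eventually (by simpa using hDn)
  have hs : ∀ᶠ s : ℂ in 𝓝 0, ((0 : ℂ), s) ∈ D := by
    have : Continuous fun s : ℂ => ((0 : ℂ), s) := by fun_prop
    exact this.continuousAt.eventually (by simpa using hDn)
  have hmulx : ∀ c : ℂ, Tendsto (fun x : ℂ => c * x) (𝓝 0) (𝓝 0) := fun c => by
    have : Continuous fun x : ℂ => c * x := by fun_prop
    simpa using this.tendsto 0
  have hΦd : ∀ z ∈ D, DifferentiableAt ℂ Φ z := fun z hz => hΦ.differentiableAt (hD.mem_nhds hz)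
  have hdx : ∀ j, AnalyticAt ℂ (fun x => Φ (x, 0) j - Φ (0, 0) j) 0 := fun j => by
    rw [Complex.analyticAt_iff_eventually_differentiableAt]
    filter_upwards [hx] with x hx
    have h1 : DifferentiableAt ℂ (fun x : ℂ => Φ (x, 0)) x :=
      DifferentiableAt.comp (f := fun x : ℂ => (x, (0 : ℂ))) x (hΦd _ hx) (by fun_prop)
    exact (differentiableAt_pi.1 h1 j).sub_const _
  have hds : ∀ j, AnalyticAt ℂ (fun s => Φ (0, s) j - Φ (0, 0) j) 0 := fun j => by
    rw [Complex.analyticAt_iff_eventually_differentiableAt]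
    filter_upwards [hs] with s hs
    have h1 : DifferentiableAt ℂ (fun s : ℂ => Φ (0, s)) s :=
      DifferentiableAt.comp (f := fun s : ℂ => ((0 : ℂ), s)) s (hΦd _ hs) (by fun_prop)
    exact (differentiableAt_pi.1 h1 j).sub_const _
  have hG : ∀ j, AnalyticAt ℂ (fun x => deriv (fun s => Φ (x, s) j) 0) 0 := fun j =>
    analyticAt_deriv_snd (Φ := fun z => Φ z j) (differentiableOn_pi.1 hΦ j) hD h0D
  have hGinv : ∀ j, ∀ᶠ x in 𝓝 0,
      deriv (fun s => Φ (ω * x, s) j) 0 = ω ^ a * deriv (fun s => Φ (x, s) j) 0 := fun j => by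
    filter_upwards [hx, (hmulx ω).eventually hx] with x hx1 hx2
    have hev : (fun s => Φ (ω * x, μ * s) j) =ᶠ[𝓝 0] fun s => Φ (x, s) j := by
      have c1 : ContinuousAt (fun s : ℂ => (x, s)) 0 := by fun_prop
      have c2 : ContinuousAt (fun s : ℂ => (ω * x, μ * s)) 0 := by fun_prop
      filter_upwards [c1.eventually (hD.mem_nhds hx1),
        c2.eventually (hD.mem_nhds (by simpa using hx2))] with s h1 h2
      exact congrFun (hinv _ h1 h2) j
    have := hev.deriv_eq
    rw [deriv_comp_mul_left μ (fun s => Φ (ω * x, s) j) 0, mul_zero, smul_eq_mul] at this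
    rw [← this]
    linear_combination (-deriv (fun s => Φ (ω * x, s) j) 0) * hka
  have hG0 : ∀ j, deriv (fun s => Φ (0, s) j) 0 = 0 := fun j => by
    have := (hGinv j).self_of_nhds
    rw [mul_zero] at this
    by_contra hne
    exact hω.pow_ne_one_of_pos_of_lt ha han (mul_right_cancel₀ hne (by rw [← this, one_mul]))
  choose α hα using fun j => exists_tendsto_of_homogeneous (hdx j) (sub_self _) hω le_rfl (by
    filter_upwards [hx, (hmulx ω).eventually hx] with x h1 h2
    have := congrFun (hinv _ h1 (by simpa using h2)) j
    simp only [mul_zero] at this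
    rw [this, hω.pow_eq_one, one_mul])
  choose β hβ using fun j => exists_tendsto_of_homogeneous (hds j) (sub_self _) hμprim le_rfl (by
    filter_upwards [hs, (hmulx μ).eventually hs] with x h1 h2
    have := congrFun (hinv _ h1 (by simpa using h2)) j
    simp only [mul_zero] at this
    rw [this, hμprim.pow_eq_one, one_mul])
  choose γ hγ using fun j => exists_tendsto_of_homogeneous (hG j) (hG0 j) hω han.le (hGinv j)
  have hyT : Φ (0, 0) ∈ T := hDT h0D
  have hlimα : ∀ F, DifferentiableOn ℂ F T → Tendsto (fun x : ℂ => (x ^ n)⁻¹ *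
      (F (Φ (x, 0)) - F (Φ (0, 0)))) (𝓝[≠] 0) (𝓝 (fderiv ℂ F (Φ (0, 0)) α)) := fun F hF => by
    have hFy := (hF.differentiableAt (hT.mem_nhds hyT)).hasFDerivAt
    have := hFy.hasFDerivWithinAt (s := Set.univ) |>.lim (l := 𝓝[≠] (0 : ℂ))
      (c := fun x => (x ^ n)⁻¹) (d := fun x => Φ (x, 0) - Φ (0, 0)) (v := α) ?_
      (Eventually.of_forall fun _ => Set.mem_univ _) ?_
    · simpa using this
    · refine Tendsto.mono_left ?_ nhdsWithin_le_nhds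
      rw [tendsto_pi_nhds]
      intro j
      simpa using (hdx j).continuousAt.tendsto
    · rw [tendsto_pi_nhds]
      exact fun j => by simpa using hα j
  have hlimβ : ∀ F, DifferentiableOn ℂ F T → Tendsto (fun s : ℂ => (s ^ m)⁻¹ *
      (F (Φ (0, s)) - F (Φ (0, 0)))) (𝓝[≠] 0) (𝓝 (fderiv ℂ F (Φ (0, 0)) β)) := fun F hF => by
    have hFy := (hF.differentiableAt (hT.mem_nhds hyT)).hasFDerivAt
    have := hFy.hasFDerivWithinAt (s := Set.univ) |>.lim (l := 𝓝[≠] (0 : ℂ))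
      (c := fun x => (x ^ m)⁻¹) (d := fun x => Φ (0, x) - Φ (0, 0)) (v := β) ?_
      (Eventually.of_forall fun _ => Set.mem_univ _) ?_
    · simpa using this
    · refine Tendsto.mono_left ?_ nhdsWithin_le_nhds
      rw [tendsto_pi_nhds]
      intro j
      simpa using (hds j).continuousAt.tendsto
    · rw [tendsto_pi_nhds]
      exact fun j => by simpa using hβ j
  have hlimγ : ∀ F, DifferentiableOn ℂ F T → Tendsto (fun x : ℂ => (x ^ a)⁻¹ *
      deriv (fun s => F (Φ (x, s))) 0) (𝓝[≠] 0) (𝓝 (fderiv ℂ F (Φ (0, 0)) γ)) := fun F hF => by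
    have hc : Tendsto (fun x : ℂ => Φ (x, 0)) (𝓝[≠] 0) (𝓝 (Φ (0, 0))) := by
      refine Tendsto.mono_left ?_ nhdsWithin_le_nhds
      exact ContinuousAt.comp (f := fun x : ℂ => (x, (0 : ℂ))) (hΦd _ h0D).continuousAt
        (by fun_prop)
    have hsum : ∀ (L : (Fin 2 → ℂ) →L[ℂ] ℂ) (v : Fin 2 → ℂ),
        L v = ∑ j, v j * L (Pi.single j 1) := fun L v => by
      conv_lhs => rw [← Finset.univ_sum_single v]
      rw [map_sum]
      refine Finset.sum_congr rfl fun j _ => ?_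
      rw [show Pi.single j (v j) = v j • (Pi.single j (1 : ℂ) : Fin 2 → ℂ) by
        rw [← Pi.single_smul]; simp, map_smul, smul_eq_mul]
    rw [hsum]
    have hlim := tendsto_finsetSum Finset.univ fun j _ => (hγ j).mul
      ((hF.continuousAt_fderiv_apply hT hyT (Pi.single j 1)).tendsto.comp hc)
    refine hlim.congr' ?_
    filter_upwards [hx.filter_mono nhdsWithin_le_nhds] with x hx
    have d1 : HasDerivAt (fun s => Φ (x, s)) (deriv (fun s => Φ (x, s)) 0) 0 :=
      (DifferentiableAt.comp (f := fun s : ℂ => (x, s)) 0 (hΦd _ hx) (by fun_prop)).hasDerivAt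
    have d2 := (hF.differentiableAt (hT.mem_nhds (hDT hx))).hasFDerivAt.comp_hasDerivAt 0 d1
    have d3 : deriv (fun s => F (Φ (x, s))) 0 = _ := d2.deriv
    rw [d3, hsum, Finset.mul_sum]
    refine Finset.sum_congr rfl fun j _ => ?_
    rw [(hasDerivAt_pi.1 d1 j).deriv]
    simp only [Function.comp_apply]
    ring
  -- Two limits of functions which agree near `0`, except possibly at `0`.
  have key : ∀ {u w : ℂ → ℂ} {b c : ℂ}, Tendsto u (𝓝[≠] 0) (𝓝 b) → (∀ᶠ x in 𝓝[≠] 0, u x = w x) →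
      Tendsto w (𝓝[≠] 0) (𝓝 c) → b = c := fun h1 h2 h3 =>
    tendsto_nhds_unique (h1.congr' h2) h3
  have hx' := hx.filter_mono (nhdsWithin_le_nhds (s := {(0 : ℂ)}ᶜ))
  have hs' := hs.filter_mono (nhdsWithin_le_nhds (s := {(0 : ℂ)}ᶜ))
  have hne : ∀ᶠ x : ℂ in 𝓝[≠] 0, x ≠ 0 := self_mem_nhdsWithin
  have hderiv : ∀ {F : (Fin 2 → ℂ) → ℂ} {M : ℂ × ℂ → ℂ} {x : ℂ}, (∀ z ∈ D, F (Φ z) = M z) →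
      (x, 0) ∈ D → deriv (fun s => F (Φ (x, s))) 0 = deriv (fun s => M (x, s)) 0 := by
    intro F M x hFM hx
    have c1 : ContinuousAt (fun s : ℂ => (x, s)) 0 := by fun_prop
    exact Filter.EventuallyEq.deriv_eq ((c1.eventually (hD.mem_nhds hx)).mono fun s hs => hFM _ hs)
  refine not_biorthogonal_three (fderiv ℂ F₁ (Φ (0, 0))) (fderiv ℂ F₂ (Φ (0, 0)))
    (fderiv ℂ F₃ (Φ (0, 0))) α γ β ⟨?_, ?_, ?_⟩ ⟨?_, ?_, ?_⟩ ⟨?_, ?_, ?_⟩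
  · refine key (hlimα _ hF₁) ?_ tendsto_const_nhds
    filter_upwards [hx', hne] with x hx hne
    simp [h₁ _ hx, h₁ _ h0D, hn, hne]
  · refine key (hlimγ _ hF₁) ?_ tendsto_const_nhds
    filter_upwards [hx'] with x hx
    simp [hderiv h₁ hx]
  · refine key (hlimβ _ hF₁) ?_ tendsto_const_nhds
    filter_upwards [hs'] with x hx
    simp [h₁ _ hx, h₁ _ h0D, hn]
  · refine key (hlimα _ hF₂) ?_ tendsto_const_nhds
    filter_upwards [hx'] with x hx
    simp [h₂ _ hx, h₂ _ h0D]
  · refine key (hlimγ _ hF₂) ?_ tendsto_const_nhds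
    filter_upwards [hx', hne] with x hx hne
    simp [hderiv h₂ hx, hne]
  · refine key (hlimβ _ hF₂) ?_ tendsto_const_nhds
    filter_upwards [hs'] with x hx
    simp [h₂ _ hx, h₂ _ h0D, ha]
  · refine key (hlimα _ hF₃) ?_ tendsto_const_nhds
    filter_upwards [hx'] with x hx
    simp [h₃ _ hx, h₃ _ h0D]
  · refine key (hlimγ _ hF₃) ?_ tendsto_const_nhds
    filter_upwards [hx'] with x hx
    have : m - 1 ≠ 0 := by lia
    simp [hderiv h₃ hx, this]
  · refine key (hlimβ _ hF₃) ?_ tendsto_const_nhds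
    filter_upwards [hs', hne] with x hx hne
    simp [h₃ _ hx, h₃ _ h0D, hm0, hne]

/-- The quotient of `ℂ²` by the cyclic group of the maps `(ζ, v) ↦ (c ζ, c ^ k v)`, with
`c ^ n = 1`, is singular at the image of the origin, unless `n` divides `k`. -/
theorem IsUniformization.not_isGermIso {X : Type*} [TopologicalSpace X]
    {Hol : Set X → (X → ℂ) → Prop} {W : Set (ℂ × ℂ)} {Ψ : ℂ × ℂ → X}
    (hΨ : IsUniformization Hol W Ψ) (hW : (0, 0) ∈ W) {n : ℕ} (hn : n ≠ 0) {k : ℤ}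
    (hnk : ¬ (n : ℤ) ∣ k)
    (hker : ∀ p ∈ W, ∀ q ∈ W, Ψ p = Ψ q ↔ ∃ c : ℂ, c ^ n = 1 ∧ q = (c * p.1, c ^ k * p.2))
    (y : Fin 2 → ℂ) : ¬ IsGermIso Hol
      (fun (V : Set (Fin 2 → ℂ)) (f : (Fin 2 → ℂ) → ℂ) => DifferentiableOn ℂ f V) (Ψ (0, 0)) y := by
  rintro ⟨e, he0, -, he⟩
  have hn' : (n : ℤ) ≠ 0 := by exact_mod_cast hn
  obtain ⟨a, ha⟩ := Int.eq_ofNat_of_zero_le (Int.emod_nonneg (-k) hn')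
  have hale : (a : ℤ) < n := ha ▸ Int.emod_lt_of_pos _ (by lia)
  have han : (n : ℤ) ∣ k + a := by
    have h1 := Int.emod_add_mul_ediv (-k) n
    exact ⟨-(-k / n), by rw [← ha]; linear_combination h1⟩
  have ha0 : a ≠ 0 := by
    rintro rfl
    exact hnk (by simpa using han)
  have hcka : ∀ c : ℂ, c ^ n = 1 → c ^ k * c ^ a = 1 := by
    intro c hc
    have hc0 : c ≠ 0 := by
      rintro rfl
      simp [hn] at hc
    obtain ⟨t, ht⟩ := han
    rw [← zpow_natCast, ← zpow_add₀ hc0, ht, zpow_mul, zpow_natCast, hc, one_zpow]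
  obtain ⟨ω, hω⟩ : ∃ ω : ℂ, IsPrimitiveRoot ω n := ⟨_, Complex.isPrimitiveRoot_exp n hn⟩
  have hcm : ∀ c : ℂ, c ^ n = 1 → (c ^ k) ^ orderOf (ω ^ k) = 1 := by
    intro c hc
    have : NeZero n := ⟨hn⟩
    obtain ⟨i, -, rfl⟩ := hω.eq_pow_of_pow_eq_one hc
    rw [← zpow_natCast ω i, zpow_comm, ← zpow_natCast, zpow_comm, zpow_natCast, zpow_natCast,
      pow_orderOf_eq_one, one_pow]
  set V := e.source ∩ Ψ '' W with hV
  have hVo : IsOpen V := e.open_source.inter (hΨ.isOpen_image W subset_rfl hΨ.isOpen)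
  set D := W ∩ Ψ ⁻¹' V with hD
  have hDo : IsOpen D := hΨ.continuousOn.isOpen_inter_preimage hΨ.isOpen hVo
  have h0D : (0, 0) ∈ D := ⟨hW, he0, _, hW, rfl⟩
  have hTo : IsOpen (e '' V) := e.isOpen_image_of_subset_source hVo Set.inter_subset_left
  have hΦ : DifferentiableOn ℂ (fun z => e (Ψ z)) D := by
    rw [differentiableOn_pi]
    intro j
    have h1 : Hol V fun x => e x j := by
      rw [he V Set.inter_subset_left hVo]
      have : DifferentiableOn ℂ (fun w : Fin 2 → ℂ => w j) (e '' V) := by fun_prop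
      refine this.congr ?_
      rintro _ ⟨x, hx, rfl⟩
      simp [e.left_inv hx.1]
    exact (hΨ.hol_iff V Set.inter_subset_right hVo _).1 h1
  -- Invariant polynomials are holomorphic functions of the coordinates on the target of `e`.
  have hF : ∀ M : ℂ × ℂ → ℂ, Differentiable ℂ M →
      (∀ (c : ℂ) (z : ℂ × ℂ), c ^ n = 1 → M (c * z.1, c ^ k * z.2) = M z) →
      ∃ F : (Fin 2 → ℂ) → ℂ, DifferentiableOn ℂ F (e '' V) ∧ ∀ z ∈ D, F (e (Ψ z)) = M z := by
    intro M hM hMinv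
    have hMΨ : ∀ p ∈ W, M (Function.invFunOn Ψ W (Ψ p)) = M p := fun p hp =>
      eqOn_comp_invFunOn (fun p hp q hq h => by
        obtain ⟨c, hc, rfl⟩ := (hker p hp q hq).1 h
        exact (hMinv c p hc).symm) hp
    refine ⟨(fun x => M (Function.invFunOn Ψ W x)) ∘ e.symm, ?_, fun z hz => ?_⟩
    · refine (he V Set.inter_subset_left hVo _).1 ?_
      rw [hΨ.hol_iff V Set.inter_subset_right hVo]
      exact hM.differentiableOn.congr fun z hz => hMΨ z hz.1
    · simp [e.left_inv hz.2.1, hMΨ z hz.1]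
  obtain ⟨F₁, hF₁, h₁⟩ := hF (fun z => z.1 ^ n) (by fun_prop) fun c z hc => by
    simp [mul_pow, hc]
  obtain ⟨F₂, hF₂, h₂⟩ := hF (fun z => z.1 ^ a * z.2) (by fun_prop) fun c z hc => by
    simp only [mul_pow]
    linear_combination (z.1 ^ a * z.2) * hcka c hc
  obtain ⟨F₃, hF₃, h₃⟩ := hF (fun z => z.2 ^ orderOf (ω ^ k)) (by fun_prop) fun c z hc => by
    simp only [mul_pow, hcm c hc, one_mul]
  refine not_invariants_factor hDo h0D hΦ ha0 (by lia) hω (hcka ω hω.pow_eq_one) ?_ hTo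
    (fun z hz => ⟨_, hz.2, rfl⟩) hF₁ hF₂ hF₃ h₁ h₂ h₃
  intro z hz hz'
  have := (hker z hz.1 _ hz'.1).2 ⟨ω, hω.pow_eq_one, rfl⟩
  simp only [this]

/-! ### Orbifold charts -/

namespace OrbifoldChart

variable {X : Type u} [TopologicalSpace X] (c : OrbifoldChart X)

theorem analyticAt_act (g : c.G) {z : ℂ} (hz : z ∈ c.domain) : AnalyticAt ℂ (c.act g) z :=
  (c.act_holomorphic g).analyticAt (c.isOpen_domain.mem_nhds hz)

theorem act_inv_act (g : c.G) {z : ℂ} (hz : z ∈ c.domain) : c.act g⁻¹ (c.act g z) = z := by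
  rw [← c.act_mul _ _ z hz, inv_mul_cancel, c.act_one z hz]

theorem deriv_act_mul (g h : c.G) {z : ℂ} (hz : z ∈ c.domain) :
    deriv (c.act (g * h)) z = deriv (c.act g) (c.act h z) * deriv (c.act h) z := by
  have h1 : c.act (g * h) =ᶠ[𝓝 z] c.act g ∘ c.act h := by
    filter_upwards [c.isOpen_domain.mem_nhds hz] with t ht
    exact c.act_mul g h t ht
  rw [h1.deriv_eq]
  exact deriv_comp z (c.analyticAt_act g (c.act_mem h z hz)).differentiableAt
    (c.analyticAt_act h hz).differentiableAt

theorem deriv_act_one {z : ℂ} (hz : z ∈ c.domain) : deriv (c.act 1) z = 1 := by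
  have h1 : c.act 1 =ᶠ[𝓝 z] id := by
    filter_upwards [c.isOpen_domain.mem_nhds hz] with t ht
    exact c.act_one t ht
  rw [h1.deriv_eq, deriv_id]

/-- By the identity theorem, an element of the group of a chart which acts trivially near a point
is trivial. -/
theorem eq_one_of_eventually {g : c.G} {z : ℂ} (hz : z ∈ c.domain)
    (h : ∀ᶠ t in 𝓝 z, c.act g t = t) : g = 1 := by
  refine c.act_effective g fun w hw => ?_
  exact AnalyticOnNhd.eqOn_of_preconnected_of_eventuallyEq
    (fun t ht => c.analyticAt_act g ht) analyticOnNhd_id c.isConnected_domain.isPreconnected hz h hw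

theorem isTransition_act (g : c.G) {z : ℂ} (hz : z ∈ c.domain) :
    IsTransition c c (c.act g) z (c.act g z) where
  mem_left := hz
  mem_right := c.act_mem g z hz
  analyticAt := c.analyticAt_act g hz
  map_eq := rfl
  deriv_ne_zero h := by
    have h1 := c.deriv_act_mul g⁻¹ g hz
    rw [inv_mul_cancel, c.deriv_act_one hz, h, mul_zero] at h1
    exact one_ne_zero h1
  comm := by
    filter_upwards [c.isOpen_domain.mem_nhds hz] with t ht
    exact ((c.toFun_eq_iff t ht _ (c.act_mem g t ht)).2 ⟨g, rfl⟩).symm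

/-- The stabilizer of a point of an orbifold chart. -/
def stabilizer {z : ℂ} (hz : z ∈ c.domain) : Subgroup c.G where
  carrier := {g | c.act g z = z}
  one_mem' := c.act_one z hz
  mul_mem' {g h} hg hh := by
    change c.act (g * h) z = z
    rw [c.act_mul g h z hz, show c.act h z = z from hh, show c.act g z = z from hg]
  inv_mem' {g} hg := by
    change c.act g⁻¹ z = z
    conv_lhs => rw [← show c.act g z = z from hg]
    exact c.act_inv_act g hz

/-- The action of the stabilizer of a point on the tangent space at this point. -/
def isotropyCharacter {z : ℂ} (hz : z ∈ c.domain) : c.stabilizer hz →* ℂ where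
  toFun g := deriv (c.act g) z
  map_one' := c.deriv_act_one hz
  map_mul' g h := by
    have := c.deriv_act_mul g h hz
    rwa [show c.act h z = z from h.2] at this

/-- The average over the stabilizer of `z₀`, weighted by the isotropy character and up to a constant
factor, of the coordinate `z - z₀`; it linearizes the action of the stabilizer. -/
def linearizer {z₀ : ℂ} (hz : z₀ ∈ c.domain) (z : ℂ) : ℂ :=
  ∑ᶠ g : c.stabilizer hz, c.isotropyCharacter hz g⁻¹ * (c.act g z - z₀)

theorem linearizer_self {z₀ : ℂ} (hz : z₀ ∈ c.domain) : c.linearizer hz z₀ = 0 := by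
  refine finsum_eq_zero_of_forall_eq_zero fun g => ?_
  rw [show c.act g z₀ = z₀ from g.2, sub_self, mul_zero]

theorem linearizer_act {z₀ : ℂ} (hz : z₀ ∈ c.domain) (k : c.stabilizer hz) {z : ℂ}
    (hzd : z ∈ c.domain) :
    c.linearizer hz (c.act k z) = c.isotropyCharacter hz k * c.linearizer hz z := by
  have := Fintype.ofFinite (c.stabilizer hz)
  simp only [linearizer, finsum_eq_sum_of_fintype]
  rw [Finset.mul_sum]
  refine Fintype.sum_equiv (Equiv.mulRight k) _ _ fun g => ?_
  simp only [Equiv.coe_mulRight, mul_inv_rev, map_mul, Subgroup.coe_mul]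
  rw [← c.act_mul _ _ z hzd, ← mul_assoc, ← mul_assoc, ← map_mul, mul_inv_cancel, map_one, one_mul]

theorem hasDerivAt_linearizer {z₀ : ℂ} (hz : z₀ ∈ c.domain) :
    HasDerivAt (c.linearizer hz) (Nat.card (c.stabilizer hz)) z₀ := by
  have := Fintype.ofFinite (c.stabilizer hz)
  have h : HasDerivAt (fun z => ∑ g : c.stabilizer hz,
      c.isotropyCharacter hz g⁻¹ * (c.act g z - z₀))
      (∑ g : c.stabilizer hz, c.isotropyCharacter hz g⁻¹ * deriv (c.act g) z₀) z₀ :=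
    HasDerivAt.fun_sum fun g _ =>
      (((c.analyticAt_act g hz).differentiableAt.hasDerivAt.sub_const z₀).const_mul _)
  have h1 : ∀ g : c.stabilizer hz, c.isotropyCharacter hz g⁻¹ * deriv (c.act g) z₀ = 1 :=
    fun g => by
      rw [show deriv (c.act g) z₀ = c.isotropyCharacter hz g from rfl, ← map_mul, inv_mul_cancel,
        map_one]
  simp only [h1, Finset.sum_const, Finset.card_univ, nsmul_eq_mul, mul_one] at h
  rw [Nat.card_eq_fintype_card]
  refine h.congr_of_eventuallyEq (Eventually.of_forall fun z => ?_)
  simp only [linearizer, finsum_eq_sum_of_fintype]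

theorem analyticAt_linearizer {z₀ : ℂ} (hz : z₀ ∈ c.domain) :
    AnalyticAt ℂ (c.linearizer hz) z₀ := by
  have := Fintype.ofFinite (c.stabilizer hz)
  have h : DifferentiableOn ℂ (fun z => ∑ g : c.stabilizer hz,
      c.isotropyCharacter hz g⁻¹ * (c.act g z - z₀)) c.domain :=
    DifferentiableOn.fun_sum fun g _ => ((c.act_holomorphic g).sub_const z₀).const_mul _
  refine AnalyticAt.congr (h.analyticAt (c.isOpen_domain.mem_nhds hz)) ?_
  refine Eventually.of_forall fun z => ?_
  simp only [linearizer, finsum_eq_sum_of_fintype]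

/-- The stabilizer of a point acts faithfully on the tangent space at this point. -/
theorem isotropyCharacter_injective {z₀ : ℂ} (hz : z₀ ∈ c.domain) :
    Function.Injective (c.isotropyCharacter hz) := by
  have hφ' : deriv (c.linearizer hz) z₀ ≠ 0 := by
    rw [(c.hasDerivAt_linearizer hz).deriv]
    exact_mod_cast Nat.card_pos.ne'
  have hs := (c.analyticAt_linearizer hz).hasStrictDerivAt
  have hl : ∀ᶠ z in 𝓝 z₀, hs.localInverse _ _ _ hφ' (c.linearizer hz z) = z :=
    HasStrictDerivAt.eventually_left_inverse ..
  rw [injective_iff_map_eq_one]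
  intro g hg
  have ht : Tendsto (c.act g) (𝓝 z₀) (𝓝 z₀) := by
    have := (c.analyticAt_act g hz).continuousAt.tendsto
    rwa [show c.act g z₀ = z₀ from g.2] at this
  refine Subtype.ext (c.eq_one_of_eventually hz ?_)
  filter_upwards [hl, ht.eventually hl, c.isOpen_domain.mem_nhds hz] with z h1 h2 h3
  rw [← h2, c.linearizer_act hz g h3, hg, one_mul, h1]

/-- Near a point with stabilizer of order `n`, an orbifold chart is, in a suitable coordinate, the
quotient of a disc by the rotations of order dividing `n`. -/
theorem exists_linearization {z₀ : ℂ} (hz : z₀ ∈ c.domain) :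
    ∃ ε > 0, ∃ ψ : ℂ → ℂ, ψ 0 = z₀ ∧ ∀ x ∈ Metric.ball (0 : ℂ) ε,
      ψ x ∈ c.domain ∧ DifferentiableAt ℂ ψ x ∧ deriv ψ x ≠ 0 ∧ ∀ y ∈ Metric.ball (0 : ℂ) ε,
        (∃ g, c.act g (ψ x) = ψ y) ↔ ∃ ω : ℂ, ω ^ Nat.card (c.stabilizer hz) = 1 ∧ ω * x = y := by
  set n := Nat.card (c.stabilizer hz) with hn
  have hn0 : n ≠ 0 := Nat.card_pos.ne'
  set φ := c.linearizer hz with hφ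
  set χ := c.isotropyCharacter hz with hχ
  have hφa : AnalyticAt ℂ φ z₀ := c.analyticAt_linearizer hz
  have hφ0 : φ z₀ = 0 := c.linearizer_self hz
  have hφ' : deriv φ z₀ ≠ 0 := by
    rw [(c.hasDerivAt_linearizer hz).deriv]
    exact_mod_cast hn0
  have hs := hφa.hasStrictDerivAt
  obtain ⟨ψ, hψ⟩ : ∃ ψ, ψ = hs.localInverse _ _ _ hφ' := ⟨_, rfl⟩
  have hψa : AnalyticAt ℂ ψ 0 := by
    rw [← hφ0, hψ]
    exact hφa.analyticAt_localInverse hφ'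
  have hψ0 : ψ 0 = z₀ := by
    rw [← hφ0, hψ]
    exact HasStrictFDerivAt.localInverse_apply_image ..
  have hψ' : deriv ψ 0 ≠ 0 := by
    have h := (hs.to_localInverse hφ').hasDerivAt.deriv
    rw [hφ0, ← hψ] at h
    exact h ▸ inv_ne_zero hφ'
  have hr : ∀ᶠ x in 𝓝 0, φ (ψ x) = x := by
    rw [← hφ0, hψ]
    exact HasStrictDerivAt.eventually_right_inverse ..
  have hl : ∀ᶠ z in 𝓝 z₀, ψ (φ z) = z := by
    rw [hψ]
    exact HasStrictDerivAt.eventually_left_inverse ..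
  have hdom := c.isOpen_domain.mem_nhds hz
  have hlact : ∀ k : c.stabilizer hz, ∀ᶠ z in 𝓝 z₀, ψ (φ (c.act k z)) = c.act k z := fun k => by
    have : Tendsto (c.act k) (𝓝 z₀) (𝓝 z₀) := by
      have := (c.analyticAt_act k hz).continuousAt.tendsto
      rwa [show c.act k z₀ = z₀ from k.2] at this
    exact this.eventually hl
  have hχn : ∀ g, χ g ^ n = 1 := fun g => by rw [← map_pow, pow_card_eq_one', map_one]
  have hχsurj : ∀ ω : ℂ, ω ^ n = 1 → ∃ g, χ g = ω := by
    have : NeZero n := ⟨hn0⟩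
    let f : c.stabilizer hz → rootsOfUnity n ℂ := fun g => rootsOfUnity.mkOfPowEq (χ g) (hχn g)
    have hf : Function.Bijective f := by
      refine Function.Injective.bijective_of_nat_card_le
        (fun g h hgh => c.isotropyCharacter_injective hz ?_) ?_
      · have := congrArg (fun ζ : rootsOfUnity n ℂ => ((ζ : ℂˣ) : ℂ)) hgh
        simpa [f] using this
      · rw [Complex.card_rootsOfUnity]
    intro ω hω
    obtain ⟨g, hg⟩ := hf.2 (rootsOfUnity.mkOfPowEq ω hω)
    refine ⟨g, ?_⟩
    have := congrArg (fun ζ : rootsOfUnity n ℂ => ((ζ : ℂˣ) : ℂ)) hg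
    simpa [f] using this
  have hψt : Tendsto ψ (𝓝 0) (𝓝 z₀) := hψ0 ▸ hψa.continuousAt.tendsto
  have ev1 : ∀ᶠ x in 𝓝 0, ψ x ∈ c.domain ∧ DifferentiableAt ℂ ψ x ∧ deriv ψ x ≠ 0 ∧ φ (ψ x) = x ∧
      ∀ k : c.stabilizer hz, ψ (φ (c.act k (ψ x))) = c.act k (ψ x) := by
    filter_upwards [hψt.eventually hdom, Complex.analyticAt_iff_eventually_differentiableAt.1 hψa,
      hψa.deriv.continuousAt.eventually_ne hψ', hr, hψt.eventually (eventually_all.2 hlact)]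
      with x h1 h2 h3 h4 h5
    exact ⟨h1, h2, h3, h4, h5⟩
  -- Elements of the group which move `z₀` move a whole neighbourhood of it off itself.
  have ev2 : ∀ᶠ q : ℂ × ℂ in 𝓝 (0, 0), ∀ g, c.act g (ψ q.1) = ψ q.2 → g ∈ c.stabilizer hz := by
    rw [eventually_all]
    intro g
    by_cases hg : g ∈ c.stabilizer hz
    · exact Eventually.of_forall fun _ _ => hg
    have c1 : Tendsto (fun q : ℂ × ℂ => c.act g (ψ q.1)) (𝓝 (0, 0)) (𝓝 (c.act g z₀)) :=
      (c.analyticAt_act g hz).continuousAt.tendsto.comp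
        (hψt.comp (continuous_fst.tendsto ((0 : ℂ), (0 : ℂ))))
    have c2 : Tendsto (fun q : ℂ × ℂ => ψ q.2) (𝓝 (0, 0)) (𝓝 z₀) :=
      hψt.comp (continuous_snd.tendsto ((0 : ℂ), (0 : ℂ)))
    filter_upwards [(c1.sub c2).eventually_ne (sub_ne_zero.2 hg)] with q hq h
    exact absurd (sub_eq_zero.2 h) hq
  obtain ⟨ε₁, hε₁, h1⟩ := Metric.eventually_nhds_iff_ball.1 ev1
  obtain ⟨ε₂, hε₂, h2⟩ := Metric.eventually_nhds_iff_ball.1 ev2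
  refine ⟨min ε₁ ε₂, lt_min hε₁ hε₂, ψ, hψ0, fun x hx => ?_⟩
  have hb1 := Metric.ball_subset_ball (x := (0 : ℂ)) (min_le_left ε₁ ε₂)
  have hb2 := Metric.ball_subset_ball (x := (0 : ℂ)) (min_le_right ε₁ ε₂)
  obtain ⟨a1, a2, a3, a4, a5⟩ := h1 x (hb1 hx)
  refine ⟨a1, a2, a3, fun y hy => ⟨?_, ?_⟩⟩
  · rintro ⟨g, hg⟩
    have hgs := h2 (x, y) (by rw [← ball_prod_same]; exact ⟨hb2 hx, hb2 hy⟩) g hg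
    refine ⟨χ ⟨g, hgs⟩, hχn _, ?_⟩
    have := c.linearizer_act hz ⟨g, hgs⟩ a1
    rw [hg, ← hφ, (h1 y (hb1 hy)).2.2.2.1, a4] at this
    exact this.symm
  · rintro ⟨ω, hω, rfl⟩
    obtain ⟨g, rfl⟩ := hχsurj ω hω
    refine ⟨g, ?_⟩
    rw [← a5 g, hφ, c.linearizer_act hz g a1, ← hφ, a4]

end OrbifoldChart

theorem IsTransition.eventually {X : Type u} [TopologicalSpace X] {c d : OrbifoldChart X}
    {h : ℂ → ℂ} {z w : ℂ} (hh : IsTransition c d h z w) :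
    ∀ᶠ t in 𝓝 z, IsTransition c d h t (h t) := by
  have hw : h z = w := hh.map_eq
  have h1 := hh.analyticAt.continuousAt.eventually
    (hw.symm ▸ d.isOpen_domain.mem_nhds hh.mem_right)
  filter_upwards [c.isOpen_domain.mem_nhds hh.mem_left, h1, hh.analyticAt.eventually_analyticAt,
    hh.analyticAt.deriv.continuousAt.eventually_ne hh.deriv_ne_zero,
    eventually_eventually_nhds.2 hh.comm] with t a1 a2 a3 a4 a5
  exact ⟨a1, a2, a3, rfl, a4, a5⟩

/-- A change of charts from an orbifold chart to itself is given, near each point, by an element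
of the group of the chart. -/
theorem IsTransition.exists_eventuallyEq_act {X : Type u} [TopologicalSpace X]
    {c : OrbifoldChart X} {h : ℂ → ℂ} {z w : ℂ} (hh : IsTransition c c h z w) :
    ∃ g, h =ᶠ[𝓝 z] c.act g := by
  by_contra! hcon
  have h1 : ∀ g, ∀ᶠ t in 𝓝[≠] z, h t ≠ c.act g t := fun g => by
    have := (hh.analyticAt.frequently_eq_iff_eventually_eq (c.analyticAt_act g hh.mem_left)).not.2
      (hcon g)
    rwa [not_frequently] at this
  obtain ⟨t, ht, ht'⟩ := ((eventually_all.2 h1).and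
    (hh.eventually.filter_mono nhdsWithin_le_nhds)).exists
  obtain ⟨g, hg⟩ := (c.toFun_eq_iff t ht'.mem_left _ ht'.mem_right).1 ht'.comm.self_of_nhds.symm
  exact ht g hg.symm

/-- A change of charts from `c` to `d` carries the self-transitions of `c` at a point to those
of `d`, with the same derivative. -/
theorem IsTransition.exists_conj {X : Type u} [TopologicalSpace X] {c d : OrbifoldChart X}
    {h t : ℂ → ℂ} {z w : ℂ} (hh : IsTransition c d h z w) (ht : IsTransition c c t z z) :
    ∃ t', IsTransition d d t' w w ∧ deriv t' w = deriv t z := by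
  obtain ⟨k, hk, hkd⟩ := hh.inv
  obtain ⟨h1, h2⟩ := ht.comp hk
  obtain ⟨h3, h4⟩ := hh.comp h1
  refine ⟨_, h3, ?_⟩
  rw [h4, h2, hkd]
  field_simp [hh.deriv_ne_zero]

/-! ### Linear charts and lines over arbitrary charts -/

/-- The vectors `(a, b (dz) ^ r)` at `z`, in the chart `c`, and `(a', b' (dw) ^ r)` at `w`, in the
chart `d`, where `P = (z, a, b)` and `Q = (w, a', b')`, span the same line of `𝒪 ⊕ K_orb ^ r`. The
charts need not belong to a given atlas. -/
def SpanSameLine {X : Type u} [TopologicalSpace X] (r : ℤ) (c d : OrbifoldChart X)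
    (P Q : ℂ × ℂ × ℂ) : Prop :=
  ∃ h : ℂ → ℂ, IsTransition c d h P.1 Q.1 ∧
    ∃ k : ℂ, k ≠ 0 ∧ Q.2.1 = k * P.2.1 ∧ Q.2.2 = k * (P.2.2 * deriv h P.1 ^ (-r))

section

variable {X : Type u} [TopologicalSpace X] {r : ℤ} {c d e : OrbifoldChart X} {P Q R : ℂ × ℂ × ℂ}

theorem SpanSameLine.symm (h : SpanSameLine r c d P Q) : SpanSameLine r d c Q P := by
  obtain ⟨h, hh, c, hc, h1, h2⟩ := h
  obtain ⟨k, hk, hkd⟩ := hh.inv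
  have hne := zpow_ne_zero r hh.deriv_ne_zero
  refine ⟨k, hk, c⁻¹, inv_ne_zero hc, ?_, ?_⟩
  · rw [h1]
    field_simp
  · rw [h2, hkd, inv_zpow', neg_neg, zpow_neg]
    field_simp

theorem SpanSameLine.trans (h : SpanSameLine r c d P Q) (h' : SpanSameLine r d e Q R) :
    SpanSameLine r c e P R := by
  obtain ⟨h, hh, c, hc, h1, h2⟩ := h
  obtain ⟨k, hk, d, hd, h3, h4⟩ := h'
  obtain ⟨hkh, hder⟩ := hk.comp hh
  refine ⟨_, hkh, d * c, mul_ne_zero hd hc, ?_, ?_⟩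
  · rw [h3, h1]
    ring
  · rw [h4, h2, hder, mul_zpow]
    ring

end

namespace OrbifoldRiemannSurface

variable {X : Type u} [TopologicalSpace X] {S : OrbifoldRiemannSurface.{u, v} X}

/-- The chart `c`, compatible with the atlas of `S` through the change of charts `ψ` to the `i`-th
chart, is the quotient of a disc by the group of all rotations of order dividing `n`. -/
structure IsLinearChart (S : OrbifoldRiemannSurface.{u, v} X) (c : OrbifoldChart X) (n : ℕ)
    (i : S.ι) (ψ : ℂ → ℂ) : Prop where
  ne_zero : n ≠ 0
  exists_domain_eq : ∃ ε > 0, c.domain = Metric.ball 0 ε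
  exists_act_eq : ∀ g, ∃ ω : ℂ, ω ^ n = 1 ∧ c.act g = fun z => ω * z
  exists_eq_act : ∀ ω : ℂ, ω ^ n = 1 → ∃ g, c.act g = fun z => ω * z
  isTransition : ∀ z ∈ c.domain, IsTransition c (S.chart i) ψ z (ψ z)

/-- Every point of an orbifold Riemann surface is the centre of a linear chart. -/
theorem exists_isLinearChart (S : OrbifoldRiemannSurface.{u, v} X) (x : X) :
    ∃ (c : OrbifoldChart X) (ψ : ℂ → ℂ), c.toFun 0 = x ∧
      S.IsLinearChart c (S.order x) (S.covers x).choose ψ := by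
  set i := (S.covers x).choose
  set z := (S.covers x).choose_spec.choose
  obtain ⟨hz, hzx⟩ : z ∈ (S.chart i).domain ∧ (S.chart i).toFun z = x :=
    (S.covers x).choose_spec.choose_spec
  obtain ⟨ε, hε, ψ, hψ0, hψ⟩ := (S.chart i).exists_linearization hz
  set n := Nat.card ((S.chart i).stabilizer hz)
  have hn : S.order x = n := rfl
  have hn0 : n ≠ 0 := Nat.card_pos.ne'
  have : NeZero n := ⟨hn0⟩
  have hψd : DifferentiableOn ℂ ψ (Metric.ball 0 ε) := fun t ht =>
    (hψ t ht).2.1.differentiableWithinAt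
  have hψa : ∀ t ∈ Metric.ball (0 : ℂ) ε, AnalyticAt ℂ ψ t := fun t ht =>
    hψd.analyticAt (Metric.isOpen_ball.mem_nhds ht)
  have hroot : ∀ g : rootsOfUnity n ℂ, ((g : ℂˣ) : ℂ) ^ n = 1 := fun g =>
    (mem_rootsOfUnity' n _).1 g.2
  have hnorm : ∀ g : rootsOfUnity n ℂ, ‖((g : ℂˣ) : ℂ)‖ = 1 := fun g =>
    Complex.norm_eq_one_of_pow_eq_one (hroot g) hn0
  let c : OrbifoldChart X :=
    { domain := Metric.ball 0 ε
      isOpen_domain := Metric.isOpen_ball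
      isConnected_domain := (convex_ball 0 ε).isConnected ⟨0, Metric.mem_ball_self hε⟩
      G := rootsOfUnity n ℂ
      act := fun g t => ((g : ℂˣ) : ℂ) * t
      act_mem := fun g t ht => by
        rw [mem_ball_zero_iff] at ht ⊢
        rwa [norm_mul, hnorm, one_mul]
      act_one := fun t _ => by simp
      act_mul := fun g h t _ => by simp [mul_assoc]
      act_holomorphic := fun g => by fun_prop
      act_effective := fun g hg => by
        have h1 := hg (ε / 2 : ℝ) (by
          rw [mem_ball_zero_iff, Complex.norm_real, Real.norm_of_nonneg (half_pos hε).le]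
          exact half_lt_self hε)
        have h2 : ((ε / 2 : ℝ) : ℂ) ≠ 0 := Complex.ofReal_ne_zero.2 (half_pos hε).ne'
        exact Subtype.ext (Units.ext (mul_right_cancel₀ h2 (by simpa using h1)))
      toFun := fun t => (S.chart i).toFun (ψ t)
      continuousOn_toFun := (S.chart i).continuousOn_toFun.comp hψd.continuousOn
        fun t ht => (hψ t ht).1
      isOpen_image := fun V hV hVo => by
        have h1 : IsOpen (ψ '' V) := by
          rw [isOpen_iff_mem_nhds]
          rintro _ ⟨t, ht, rfl⟩
          have hs := (hψa t (hV ht)).hasStrictDerivAt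
          rw [← hs.map_nhds_eq (hψ t (hV ht)).2.2.1]
          exact image_mem_map (hVo.mem_nhds ht)
        rw [← Set.image_image]
        exact (S.chart i).isOpen_image _ (by rintro _ ⟨t, ht, rfl⟩; exact (hψ t (hV ht)).1) h1
      toFun_eq_iff := fun t ht w hw => by
        rw [(S.chart i).toFun_eq_iff _ (hψ t ht).1 _ (hψ w hw).1, (hψ t ht).2.2.2 w hw]
        constructor
        · rintro ⟨ω, hω, h⟩
          exact ⟨rootsOfUnity.mkOfPowEq ω hω, by simpa using h⟩
        · rintro ⟨g, h⟩
          exact ⟨((g : ℂˣ) : ℂ), hroot g, h⟩ }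
  refine ⟨c, ψ, by simp [c, hψ0, hzx], hn ▸ hn0, ⟨ε, hε, rfl⟩, fun g => ?_,
    fun ω (hω : ω ^ n = 1) => ?_,
    fun t ht => ⟨ht, (hψ t ht).1, hψa t ht, rfl, (hψ t ht).2.2.1,
      Eventually.of_forall fun _ => rfl⟩⟩
  · exact ⟨(((g : rootsOfUnity n ℂ) : ℂˣ) : ℂ), hroot g, rfl⟩
  · exact ⟨rootsOfUnity.mkOfPowEq ω hω, by funext t; simp [c]⟩

namespace IsLinearChart

variable {c : OrbifoldChart X} {n : ℕ} {i : S.ι} {ψ : ℂ → ℂ}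

theorem zero_mem (hc : S.IsLinearChart c n i ψ) : (0 : ℂ) ∈ c.domain := by
  obtain ⟨ε, hε, h⟩ := hc.exists_domain_eq
  exact h ▸ Metric.mem_ball_self hε

theorem mul_mem (hc : S.IsLinearChart c n i ψ) {ω : ℂ} (hω : ω ^ n = 1) {z : ℂ}
    (hz : z ∈ c.domain) : ω * z ∈ c.domain := by
  obtain ⟨g, hg⟩ := hc.exists_eq_act ω hω
  simpa [hg] using c.act_mem g z hz

/-- The changes of charts from a linear chart to itself are the rotations of order dividing `n`. -/
theorem spanSameLine_iff (hc : S.IsLinearChart c n i ψ) {r : ℤ} {P Q : ℂ × ℂ × ℂ}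
    (hP : P.1 ∈ c.domain) : SpanSameLine r c c P Q ↔ ∃ ω : ℂ, ω ^ n = 1 ∧ Q.1 = ω * P.1 ∧
      ∃ k : ℂ, k ≠ 0 ∧ Q.2.1 = k * P.2.1 ∧ Q.2.2 = k * (P.2.2 * ω ^ (-r)) := by
  have hder : ∀ ω z : ℂ, deriv (fun t => ω * t) z = ω := fun ω z => by
    simp
  constructor
  · rintro ⟨h, hh, k, hk, h1, h2⟩
    obtain ⟨g, hg⟩ := hh.exists_eventuallyEq_act
    obtain ⟨ω, hω, hgω⟩ := hc.exists_act_eq g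
    rw [hgω] at hg
    refine ⟨ω, hω, ?_, k, hk, h1, ?_⟩
    · rw [← hh.map_eq, hg.self_of_nhds]
    · rw [h2, hg.deriv_eq, hder]
  · rintro ⟨ω, hω, h1, k, hk, h2, h3⟩
    obtain ⟨g, hg⟩ := hc.exists_eq_act ω hω
    have ht := c.isTransition_act g hP
    rw [hg] at ht
    exact ⟨_, by rw [h1]; exact ht, k, hk, h2, by rw [h3, hder]⟩

end IsLinearChart

end OrbifoldRiemannSurface

/-! ### Uniformization of `ℙ(𝒪 ⊕ K_orb ^ r)` -/

/-- An affine chart of the projective line: `u v` is the normalized vector, with `N (u v) = 1` for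
a linear form `N`, on the line with affine coordinate `v`, and `V` is the affine coordinate as a
function of a vector. -/
structure IsAffineChart (u : ℂ → ℂ × ℂ) (N V : ℂ × ℂ → ℂ) : Prop where
  differentiable_u : Differentiable ℂ u
  differentiable_N : Differentiable ℂ N
  differentiableAt_V : ∀ x, N x ≠ 0 → DifferentiableAt ℂ V x
  N_u : ∀ v, N (u v) = 1
  V_u : ∀ v, V (u v) = v
  N_smul : ∀ (k : ℂ) x, N (k • x) = k * N x
  V_smul : ∀ (k : ℂ) x, k ≠ 0 → V (k • x) = V x
  eq_smul : ∀ x, N x ≠ 0 → x = N x • u (V x)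

theorem IsAffineChart.ne_zero {u : ℂ → ℂ × ℂ} {N V : ℂ × ℂ → ℂ} (hu : IsAffineChart u N V) (v : ℂ) :
    u v ≠ 0 := by
  intro h
  have h1 := hu.N_u v
  have h2 := hu.N_smul 0 0
  rw [h] at h1
  simp [h1] at h2

/-- The chart `v ↦ [1 : v]`. -/
theorem isAffineChart_fst :
    IsAffineChart (fun v => (1, v)) (fun x => x.1) (fun x => x.2 / x.1) where
  differentiable_u := by fun_prop
  differentiable_N := by fun_prop
  differentiableAt_V x hx := by fun_prop (disch := exact hx)
  N_u _ := rfl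
  V_u _ := by simp
  N_smul _ _ := rfl
  V_smul k x hk := by simp [mul_div_mul_left _ _ hk]
  eq_smul x hx := by
    ext
    · simp
    · simp only [Prod.smul_mk, smul_eq_mul]
      field_simp

/-- The chart `v ↦ [v : 1]`. -/
theorem isAffineChart_snd :
    IsAffineChart (fun v => (v, 1)) (fun x => x.2) (fun x => x.1 / x.2) where
  differentiable_u := by fun_prop
  differentiable_N := by fun_prop
  differentiableAt_V x hx := by fun_prop (disch := exact hx)
  N_u _ := rfl
  V_u _ := by simp
  N_smul _ _ := rfl
  V_smul k x hk := by simp [mul_div_mul_left _ _ hk]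
  eq_smul x hx := by
    ext
    · simp only [Prod.smul_mk, smul_eq_mul]
      field_simp
    · simp

namespace OrbifoldRiemannSurface

variable {X : Type u} [TopologicalSpace X] {S : OrbifoldRiemannSurface.{u, v} X}

theorem ProjBundle.mk_eq_mk_iff {r : ℤ} {P Q : S.FrameVector} :
    ProjBundle.mk r P = ProjBundle.mk r Q ↔
      SpanSameLine r (S.chart P.1) (S.chart Q.1) P.2.1 Q.2.1 :=
  Quotient.eq (r := S.sameLineSetoid r)

namespace IsLinearChart

variable {c : OrbifoldChart X} {n : ℕ} {i : S.ι} {ψ : ℂ → ℂ} {r : ℤ} {u : ℂ → ℂ × ℂ}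
  {N V : ℂ × ℂ → ℂ}

/-- The vector of the bundle over the `i`-th chart given by the vector `u v` over the point `z` of
a linear chart, where `p = (z, v)`. -/
def coordVector (r : ℤ) (ψ : ℂ → ℂ) (u : ℂ → ℂ × ℂ) (p : ℂ × ℂ) : ℂ × ℂ × ℂ :=
  (ψ p.1, (u p.2).1, (u p.2).2 * deriv ψ p.1 ^ (-r))

theorem coordVector_mem (hc : S.IsLinearChart c n i ψ) (r : ℤ) (hu : IsAffineChart u N V)
    {p : ℂ × ℂ} (hp : p.1 ∈ c.domain) :
    (coordVector r ψ u p).1 ∈ (S.chart i).domain ∧ (coordVector r ψ u p).2 ≠ 0 := by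
  have ht := hc.isTransition p.1 hp
  refine ⟨ht.mem_right, fun h => hu.ne_zero p.2 ?_⟩
  have h1 : (u p.2).1 = 0 := congrArg Prod.fst h
  have h2 : (u p.2).2 * deriv ψ p.1 ^ (-r) = 0 := congrArg Prod.snd h
  exact Prod.ext h1 ((mul_eq_zero.1 h2).resolve_right (zpow_ne_zero _ ht.deriv_ne_zero))

open Classical in
/-- The point of `ℙ(𝒪 ⊕ K_orb ^ r)` over the point `z` of a linear chart with affine coordinate
`v` in the fibre, where `p = (z, v)`; for `z` outside of the chart its value is irrelevant. -/
def uniformizer (hc : S.IsLinearChart c n i ψ) (r : ℤ) (hu : IsAffineChart u N V) (p : ℂ × ℂ) :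
    S.ProjBundle r :=
  if hp : p.1 ∈ c.domain then ProjBundle.mk r ⟨i, coordVector r ψ u p, hc.coordVector_mem r hu hp⟩
  else ProjBundle.mk r ⟨i, coordVector r ψ u 0, hc.coordVector_mem r hu hc.zero_mem⟩

theorem uniformizer_of_mem (hc : S.IsLinearChart c n i ψ) (hu : IsAffineChart u N V)
    {p : ℂ × ℂ} (hp : p.1 ∈ c.domain) : hc.uniformizer r hu p =
      ProjBundle.mk r ⟨i, coordVector r ψ u p, hc.coordVector_mem r hu hp⟩ :=
  dif_pos hp

theorem spanSameLine_coordVector (hc : S.IsLinearChart c n i ψ) {p : ℂ × ℂ}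
    (hp : p.1 ∈ c.domain) :
    SpanSameLine r c (S.chart i) (p.1, u p.2) (coordVector r ψ u p) :=
  ⟨ψ, hc.isTransition p.1 hp, 1, one_ne_zero, (one_mul _).symm, (one_mul _).symm⟩

theorem mk_eq_uniformizer_iff (hc : S.IsLinearChart c n i ψ) (hu : IsAffineChart u N V)
    {p : ℂ × ℂ} (hp : p.1 ∈ c.domain) {Q : S.FrameVector} :
    ProjBundle.mk r Q = hc.uniformizer r hu p ↔
      SpanSameLine r (S.chart Q.1) c Q.2.1 (p.1, u p.2) := by
  rw [hc.uniformizer_of_mem hu hp, ProjBundle.mk_eq_mk_iff]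
  exact ⟨fun h => h.trans (hc.spanSameLine_coordVector hp).symm,
    fun h => h.trans (hc.spanSameLine_coordVector hp)⟩

theorem proj_uniformizer (hc : S.IsLinearChart c n i ψ) (hu : IsAffineChart u N V) {p : ℂ × ℂ}
    (hp : p.1 ∈ c.domain) : (hc.uniformizer r hu p).proj = c.toFun p.1 := by
  rw [hc.uniformizer_of_mem hu hp]
  exact (hc.isTransition p.1 hp).comm.self_of_nhds

/-- The uniformizer lifts locally to the space of nonzero vectors over any chart of the atlas. -/
theorem exists_lift (hc : S.IsLinearChart c n i ψ) (hu : IsAffineChart u N V) {p : ℂ × ℂ}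
    (hp : p.1 ∈ c.domain) {Q : S.FrameVector} (hQ : ProjBundle.mk r Q = hc.uniformizer r hu p) :
    ∃ τ : ℂ × ℂ × ℂ → ℂ × ℂ, DifferentiableAt ℂ τ Q.2.1 ∧ τ Q.2.1 = p ∧
      ∀ᶠ q in 𝓝 Q.2.1, ∀ hq : q.1 ∈ (S.chart Q.1).domain ∧ q.2 ≠ 0,
        ProjBundle.mk r ⟨Q.1, q, hq⟩ = hc.uniformizer r hu (τ q) := by
  obtain ⟨j, Q, hQd⟩ := Q
  obtain ⟨h, hh, k, hk, h1, h2⟩ := (hc.mk_eq_uniformizer_iff hu hp).1 hQ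
  dsimp only at hh h1 h2 ⊢
  set w : ℂ × ℂ × ℂ → ℂ × ℂ := fun q => (q.2.1, q.2.2 * deriv h q.1 ^ (-r)) with hw
  have huw : u p.2 = k • w Q := Prod.ext h1 h2
  have hNQ : N (w Q) ≠ 0 := by
    intro h0
    have := hu.N_u p.2
    rw [huw, hu.N_smul, h0, mul_zero] at this
    exact zero_ne_one this
  have hwd : DifferentiableAt ℂ w Q := by
    have e1 : DifferentiableAt ℂ (fun z => deriv h z ^ (-r)) Q.1 :=
      hh.analyticAt.deriv.differentiableAt.zpow (Or.inl hh.deriv_ne_zero)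
    have e2 : DifferentiableAt ℂ (fun q : ℂ × ℂ × ℂ => deriv h q.1 ^ (-r)) Q :=
      DifferentiableAt.comp (f := fun q : ℂ × ℂ × ℂ => q.1) Q e1 (by fun_prop)
    exact DifferentiableAt.prodMk (by fun_prop) (DifferentiableAt.mul (by fun_prop) e2)
  have hhd : DifferentiableAt ℂ (fun q : ℂ × ℂ × ℂ => h q.1) Q :=
    DifferentiableAt.comp (f := fun q : ℂ × ℂ × ℂ => q.1) Q hh.analyticAt.differentiableAt
      (by fun_prop)
  refine ⟨fun q => (h q.1, V (w q)), ?_, ?_, ?_⟩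
  · exact hhd.prodMk ((hu.differentiableAt_V _ hNQ).comp Q hwd)
  · refine Prod.ext hh.map_eq ?_
    change V (w Q) = p.2
    rw [← hu.V_smul k _ hk, ← huw, hu.V_u]
  · have ev1 : ∀ᶠ q : ℂ × ℂ × ℂ in 𝓝 Q, IsTransition (S.chart j) c h q.1 (h q.1) :=
      continuousAt_fst.eventually hh.eventually
    have ev2 : ∀ᶠ q in 𝓝 Q, N (w q) ≠ 0 :=
      (hu.differentiable_N.continuous.continuousAt.comp hwd.continuousAt).eventually_ne hNQ
    filter_upwards [ev1, ev2] with q e1 e2 hq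
    refine (hc.mk_eq_uniformizer_iff hu e1.mem_right).2 ⟨h, e1, (N (w q))⁻¹, inv_ne_zero e2, ?_⟩
    have := hu.eq_smul _ e2
    have h3 : u (V (w q)) = (N (w q))⁻¹ • w q := by
      conv_rhs => rw [this, hu.N_smul, hu.N_u, mul_one, smul_smul, inv_mul_cancel₀ e2, one_smul]
    exact ⟨congrArg Prod.fst h3, congrArg Prod.snd h3⟩

theorem differentiableOn_coordVector (hc : S.IsLinearChart c n i ψ) (hu : IsAffineChart u N V) :
    DifferentiableOn ℂ (coordVector r ψ u) (c.domain ×ˢ Set.univ) := by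
  rintro p ⟨hp, -⟩
  have ht := hc.isTransition p.1 hp
  have e1 : DifferentiableAt ℂ (fun z => deriv ψ z ^ (-r)) p.1 :=
    ht.analyticAt.deriv.differentiableAt.zpow (Or.inl ht.deriv_ne_zero)
  have e2 : DifferentiableAt ℂ (fun q : ℂ × ℂ => deriv ψ q.1 ^ (-r)) p :=
    DifferentiableAt.comp (f := fun q : ℂ × ℂ => q.1) p e1 (by fun_prop)
  have e3 : DifferentiableAt ℂ (fun q : ℂ × ℂ => ψ q.1) p :=
    DifferentiableAt.comp (f := fun q : ℂ × ℂ => q.1) p ht.analyticAt.differentiableAt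
      (by fun_prop)
  have e4 : DifferentiableAt ℂ (fun q : ℂ × ℂ => u q.2) p :=
    DifferentiableAt.comp (f := fun q : ℂ × ℂ => q.2) p (hu.differentiable_u _) (by fun_prop)
  exact (e3.prodMk (e4.fst.prodMk (e4.snd.mul e2))).differentiableWithinAt

theorem continuousOn_uniformizer (hc : S.IsLinearChart c n i ψ) (hu : IsAffineChart u N V)
    {O : Set (ℂ × ℂ)} (hOc : ∀ p ∈ O, p.1 ∈ c.domain) :
    ContinuousOn (hc.uniformizer r hu) O := by
  rw [continuousOn_iff_continuous_domRestrict]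
  have h1 : Continuous fun p : O => coordVector r ψ u p :=
    ((hc.differentiableOn_coordVector hu).continuousOn.mono
      fun p hp => ⟨hOc p hp, trivial⟩).domRestrict
  have h2 : Continuous fun p : O => ProjBundle.mk r (S := S)
      ⟨i, coordVector r ψ u p, hc.coordVector_mem r hu (hOc p p.2)⟩ :=
    continuous_quotient_mk'.comp (continuous_sigmaMk.comp (h1.subtype_mk _))
  exact h2.congr fun p => (hc.uniformizer_of_mem hu (hOc p p.2)).symm

theorem isUniformization (hc : S.IsLinearChart c n i ψ) (hu : IsAffineChart u N V)
    {O : Set (ℂ × ℂ)} (hO : IsOpen O) (hOc : ∀ p ∈ O, p.1 ∈ c.domain) :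
    IsUniformization (ProjBundle.IsHolomorphicOn (S := S) (r := r)) O (hc.uniformizer r hu) where
  isOpen := hO
  continuousOn := hc.continuousOn_uniformizer hu hOc
  isOpen_image U hU hUo := by
    rw [← isQuotientMap_quotient_mk'.isOpen_preimage, isOpen_sigma_iff]
    intro j
    rw [isOpen_iff_mem_nhds]
    rintro Q ⟨p, hp, hpQ⟩
    obtain ⟨τ, hτ, hτQ, hev⟩ := hc.exists_lift hu (hOc p (hU hp)) (Q := ⟨j, Q⟩) hpQ.symm
    have h1 : ∀ᶠ q in 𝓝 Q.1, τ q ∈ U := hτ.continuousAt.eventually (by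
      rw [hτQ]
      exact hUo.mem_nhds hp)
    filter_upwards [continuous_subtype_val.continuousAt.eventually (h1.and hev)] with q hq
    exact ⟨τ q, hq.1, (hq.2 q.2).symm⟩
  hol_iff Y hY hYo f := by
    constructor
    · intro hf
      obtain ⟨F, hF, hFf⟩ := hf i
      have h1 : Set.MapsTo (coordVector r ψ u) (O ∩ hc.uniformizer r hu ⁻¹' Y)
          {p | ∃ hp : p.1 ∈ (S.chart i).domain ∧ p.2 ≠ 0, ProjBundle.mk r ⟨i, p, hp⟩ ∈ Y} := by
        rintro p ⟨hp, hpY⟩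
        rw [Set.mem_preimage, hc.uniformizer_of_mem hu (hOc p hp)] at hpY
        exact ⟨_, hpY⟩
      refine (hF.comp ((hc.differentiableOn_coordVector hu).mono
        fun p hp => ⟨hOc p hp.1, trivial⟩) h1).congr fun p hp => ?_
      obtain ⟨h2, h3⟩ := h1 hp
      rw [Function.comp_apply, Function.comp_apply, hFf _ h2 h3,
        hc.uniformizer_of_mem hu (hOc p hp.1)]
    · intro hf j
      classical
      refine ⟨fun q => if hq : q.1 ∈ (S.chart j).domain ∧ q.2 ≠ 0 then
        f (ProjBundle.mk r ⟨j, q, hq⟩) else 0, ?_, fun q hq _ => dif_pos hq⟩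
      rintro q ⟨hq, hqY⟩
      obtain ⟨p, hp, hpq⟩ := hY hqY
      obtain ⟨τ, hτ, hτq, hev⟩ := hc.exists_lift hu (hOc p hp) (Q := ⟨j, q, hq⟩) hpq.symm
      have hopen : IsOpen (O ∩ hc.uniformizer r hu ⁻¹' Y) :=
        (hc.continuousOn_uniformizer hu hOc).isOpen_inter_preimage hO hYo
      have hfp : DifferentiableAt ℂ (f ∘ hc.uniformizer r hu) (τ q) := by
        rw [hτq]
        exact hf.differentiableAt (hopen.mem_nhds ⟨hp, by rwa [Set.mem_preimage, hpq]⟩)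
      refine ((hfp.comp q hτ).congr_of_eventuallyEq ?_).differentiableWithinAt
      have e1 : ∀ᶠ q' : ℂ × ℂ × ℂ in 𝓝 q, q'.1 ∈ (S.chart j).domain :=
        continuousAt_fst.eventually ((S.chart j).isOpen_domain.mem_nhds hq.1)
      have e2 : ∀ᶠ q' : ℂ × ℂ × ℂ in 𝓝 q, q'.2 ≠ 0 := continuousAt_snd.eventually_ne hq.2
      filter_upwards [hev, e1, e2] with q' h1 h2 h3
      rw [dif_pos ⟨h2, h3⟩, h1 ⟨h2, h3⟩]
      rfl

end IsLinearChart

end OrbifoldRiemannSurface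

/-! ### The fibres of `ℙ(𝒪 ⊕ K_orb ^ r)` -/

theorem pow_gcd_eq_one_iff {ω : ℂ} {n : ℕ} {k : ℤ} :
    ω ^ Int.gcd k n = 1 ↔ ω ^ k = 1 ∧ ω ^ n = 1 := by
  have h : ω ^ k = 1 ↔ ω ^ k.natAbs = 1 := by
    obtain ⟨m, rfl | rfl⟩ := Int.eq_nat_or_neg k <;> simp
  rw [h, ← orderOf_dvd_iff_pow_eq_one, ← orderOf_dvd_iff_pow_eq_one, ← orderOf_dvd_iff_pow_eq_one]
  exact Nat.dvd_gcd_iff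

namespace OrbifoldRiemannSurface.IsLinearChart

variable {X : Type u} [TopologicalSpace X] {S : OrbifoldRiemannSurface.{u, v} X}
  {c : OrbifoldChart X} {n : ℕ} {i : S.ι} {ψ : ℂ → ℂ} {r : ℤ} {u : ℂ → ℂ × ℂ} {N V : ℂ × ℂ → ℂ}
  {u' : ℂ → ℂ × ℂ} {N' V' : ℂ × ℂ → ℂ}

theorem uniformizer_eq_uniformizer_iff (hc : S.IsLinearChart c n i ψ) (hu : IsAffineChart u N V)
    (hu' : IsAffineChart u' N' V') {p q : ℂ × ℂ} (hp : p.1 ∈ c.domain) (hq : q.1 ∈ c.domain) :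
    hc.uniformizer r hu p = hc.uniformizer r hu' q ↔ ∃ ω : ℂ, ω ^ n = 1 ∧ q.1 = ω * p.1 ∧
      ∃ k : ℂ, k ≠ 0 ∧ (u' q.2).1 = k * (u p.2).1 ∧ (u' q.2).2 = k * ((u p.2).2 * ω ^ (-r)) := by
  rw [hc.uniformizer_of_mem hu hp, hc.mk_eq_uniformizer_iff hu' hq,
    ← hc.spanSameLine_iff (P := (p.1, u p.2)) (Q := (q.1, u' q.2)) hp]
  exact ⟨fun h => (hc.spanSameLine_coordVector hp).trans h,
    fun h => (hc.spanSameLine_coordVector hp).symm.trans h⟩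

/-- The affine coordinate of the chart `u` of the projective line is multiplied by `ω ^ k` under
the map `[a : b] ↦ [a : b ω ^ (-r)]`. -/
def HasWeight (u : ℂ → ℂ × ℂ) (r k : ℤ) : Prop :=
  ∀ ω : ℂ, ω ≠ 0 → ∀ v v', (∃ t : ℂ, t ≠ 0 ∧ (u v').1 = t * (u v).1 ∧
    (u v').2 = t * ((u v).2 * ω ^ (-r))) ↔ v' = ω ^ k * v

theorem hasWeight_fst (r : ℤ) : HasWeight (fun v => (1, v)) r (-r) := by
  intro ω hω v v'
  constructor
  · rintro ⟨t, ht, h1, h2⟩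
    have : t = 1 := by simpa using h1.symm
    subst this
    simpa [mul_comm] using h2
  · rintro rfl
    exact ⟨1, one_ne_zero, by simp, by simp [mul_comm]⟩

theorem hasWeight_snd (r : ℤ) : HasWeight (fun v => (v, 1)) r r := by
  intro ω hω v v'
  have hωr := zpow_ne_zero r hω
  constructor
  · rintro ⟨t, ht, h1, h2⟩
    have : t = ω ^ r := by
      simp only [one_mul, zpow_neg] at h2
      field_simp at h2
      exact h2.symm
    subst this
    exact h1
  · rintro rfl
    exact ⟨ω ^ r, hωr, rfl, by simp [hωr]⟩

theorem ne_zero_of_pow_eq_one (hc : S.IsLinearChart c n i ψ) {ω : ℂ} (hω : ω ^ n = 1) : ω ≠ 0 := by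
  rintro rfl
  simp [hc.ne_zero] at hω

/-- In an affine chart of weight `k`, the surface is the quotient by the group of the maps
`(z, v) ↦ (ω z, ω ^ k v)`. -/
theorem uniformizer_eq_iff (hc : S.IsLinearChart c n i ψ) (hu : IsAffineChart u N V) {k : ℤ}
    (hk : HasWeight u r k) {p q : ℂ × ℂ} (hp : p.1 ∈ c.domain) (hq : q.1 ∈ c.domain) :
    hc.uniformizer r hu p = hc.uniformizer r hu q ↔
      ∃ ω : ℂ, ω ^ n = 1 ∧ q = (ω * p.1, ω ^ k * p.2) := by
  rw [hc.uniformizer_eq_uniformizer_iff hu hu hp hq]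
  refine exists_congr fun ω => and_congr_right fun hω => ?_
  rw [hk ω (hc.ne_zero_of_pow_eq_one hω), Prod.ext_iff]

theorem isOpen_prod_univ (c : OrbifoldChart X) : IsOpen (c.domain ×ˢ (Set.univ : Set ℂ)) :=
  c.isOpen_domain.prod isOpen_univ

theorem isGermIso_hirzebruchJung (hc : S.IsLinearChart c n i ψ) (hu : IsAffineChart u N V) {k : ℤ}
    (hk : HasWeight u r k) {m : ℕ} (hm : (m : ℤ) ≡ k [ZMOD n]) :
    IsGermIso (ProjBundle.IsHolomorphicOn (S := S) (r := r))
      (HirzebruchJungQuotient.IsHolomorphicOn (p := m) (q := n)) (hc.uniformizer r hu (0, 0))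
      (Quotient.mk (hirzebruchJungSetoid m n) 0) := by
  have h0 : Quotient.mk (hirzebruchJungSetoid m n) 0 = hirzebruchJungMk m n (0, 0) := by
    rw [hirzebruchJungMk]
    congr 1
    ext j
    fin_cases j <;> rfl
  have hpow : ∀ ω : ℂ, ω ^ n = 1 → ω ^ m = ω ^ k := by
    intro ω hω
    obtain ⟨t, ht⟩ := hm.dvd
    rw [show k = m + n * t by lia, zpow_add₀ (hc.ne_zero_of_pow_eq_one hω), zpow_mul, zpow_natCast,
      zpow_natCast, hω, one_zpow, mul_one]
  rw [h0]
  refine (hc.isUniformization hu (isOpen_prod_univ c) fun p hp => hp.1).isGermIso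
    (isUniformization_hirzebruchJungMk hc.ne_zero (isOpen_prod_univ c)
      fun z hz ω hω => ⟨hc.mul_mem hω hz.1, trivial⟩) (fun p hp q hq => ?_)
    ⟨hc.zero_mem, trivial⟩
  rw [hc.uniformizer_eq_iff hu hk hp.1 hq.1, hirzebruchJungMk, hirzebruchJungMk,
    hirzebruchJung_mk_eq_iff hc.ne_zero]
  refine exists_congr fun ω => and_congr_right fun hω => ?_
  rw [hpow ω hω, Prod.ext_iff]

theorem isSingularPoint_uniformizer_zero (hc : S.IsLinearChart c n i ψ) (hu : IsAffineChart u N V)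
    {k : ℤ} (hk : HasWeight u r k) (hnk : ¬ (n : ℤ) ∣ k) :
    (hc.uniformizer r hu (0, 0)).IsSingularPoint := by
  rintro ⟨y, hy⟩
  exact (hc.isUniformization hu (isOpen_prod_univ c) fun p hp => hp.1).not_isGermIso
    ⟨hc.zero_mem, trivial⟩ hc.ne_zero hnk
    (fun p hp q hq => hc.uniformizer_eq_iff hu hk hp.1 hq.1) y hy

/-- At a point of the fibre with nonzero affine coordinate the isotropy group consists of
reflections, hence the surface is smooth; likewise at the origin if all rotations act trivially on
the fibre. -/
theorem not_isSingularPoint_uniformizer (hc : S.IsLinearChart c n i ψ) (hu : IsAffineChart u N V)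
    {k : ℤ} (hk : HasWeight u r k) {v : ℂ} (hv : v ≠ 0 ∨ (n : ℤ) ∣ k) :
    ¬ (hc.uniformizer r hu (0, v)).IsSingularPoint := by
  have : NeZero n := ⟨hc.ne_zero⟩
  have hev : ∀ᶠ q : ℂ × ℂ in 𝓝 (v, v), ∀ ω : rootsOfUnity n ℂ,
      q.2 = ((ω : ℂˣ) : ℂ) ^ k * q.1 → ((ω : ℂˣ) : ℂ) ^ k = 1 := by
    rw [eventually_all]
    intro ω
    by_cases h1 : ((ω : ℂˣ) : ℂ) ^ k = 1
    · exact Eventually.of_forall fun _ _ => h1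
    have hv0 : v ≠ 0 := by
      refine hv.resolve_right ?_
      rintro ⟨t, rfl⟩
      have hω := (mem_rootsOfUnity' n _).1 ω.2
      exact h1 (by rw [zpow_mul, zpow_natCast, hω, one_zpow])
    have hcont : Continuous fun q : ℂ × ℂ => q.2 - ((ω : ℂˣ) : ℂ) ^ k * q.1 := by fun_prop
    have hne : v - ((ω : ℂˣ) : ℂ) ^ k * v ≠ 0 := fun h =>
      h1 (mul_right_cancel₀ hv0 (by linear_combination -h))
    filter_upwards [hcont.continuousAt.eventually_ne hne] with q hq h
    exact absurd (sub_eq_zero.2 h) hq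
  obtain ⟨δ, hδ, hball⟩ := Metric.eventually_nhds_iff_ball.1 hev
  have hO : IsOpen (c.domain ×ˢ Metric.ball v δ) := c.isOpen_domain.prod Metric.isOpen_ball
  have hd : Int.gcd k n ≠ 0 := by
    rw [Ne, Int.gcd_eq_zero_iff]
    exact fun h => hc.ne_zero (by exact_mod_cast h.2)
  refine fun hs => hs ⟨_, (hc.isUniformization hu hO fun p hp => hp.1).isGermIso
    (isUniformization_pow hd hO) (fun p hp q hq => ?_) ⟨hc.zero_mem, Metric.mem_ball_self hδ⟩⟩
  rw [hc.uniformizer_eq_iff hu hk hp.1 hq.1, EmbeddingLike.apply_eq_iff_eq, Prod.ext_iff]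
  constructor
  · rintro ⟨ω, hω, rfl⟩
    have h1 : ω ^ k = 1 := by
      have := hball (p.2, ω ^ k * p.2) (by rw [← ball_prod_same]; exact ⟨hp.2, hq.2⟩)
        (rootsOfUnity.mkOfPowEq ω hω)
      simpa using this
    refine ⟨?_, by simp [h1]⟩
    simp only [mul_pow]
    rw [pow_gcd_eq_one_iff.2 ⟨h1, hω⟩, one_mul]
  · rintro ⟨h1, h2⟩
    dsimp only at h1 h2
    obtain ⟨ω, hω, hpq⟩ : ∃ ω : ℂ, ω ^ Int.gcd k n = 1 ∧ q.1 = ω * p.1 := by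
      by_cases hp0 : p.1 = 0
      · rw [hp0, zero_pow hd, eq_comm, pow_eq_zero_iff hd] at h1
        exact ⟨1, one_pow _, by rw [h1, hp0, mul_zero]⟩
      · refine ⟨q.1 / p.1, ?_, by field_simp⟩
        rw [div_pow, ← h1, div_self (pow_ne_zero _ hp0)]
    obtain ⟨h3, h4⟩ := pow_gcd_eq_one_iff.1 hω
    exact ⟨ω, h4, Prod.ext hpq (by simp [h3, h2])⟩

/-- The points over the centre of a linear chart. -/
theorem exists_eq_uniformizer (hc : S.IsLinearChart c n i ψ) {z : S.ProjBundle r}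
    (hz : z.proj = c.toFun 0) :
    (∃ v, z = hc.uniformizer r isAffineChart_fst (0, v)) ∨
      z = hc.uniformizer r isAffineChart_snd (0, 0) := by
  obtain ⟨Q, rfl⟩ : ∃ Q, ProjBundle.mk r Q = z := Quotient.exists_rep z
  have ht := hc.isTransition 0 hc.zero_mem
  have hcomm : (S.chart Q.1).toFun Q.2.1.1 = (S.chart i).toFun (ψ 0) :=
    Eq.trans hz ht.comm.self_of_nhds.symm
  obtain ⟨h, hh⟩ := S.compatible _ _ _ Q.2.2.1 _ ht.mem_right hcomm
  obtain ⟨k, hk, -⟩ := ht.inv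
  obtain ⟨hkh, -⟩ := hk.comp hh
  by_cases ha : Q.2.1.2.1 = 0
  · right
    have hb : Q.2.1.2.2 ≠ 0 := fun hb => Q.2.2.2 (Prod.ext ha hb)
    have hw : Q.2.1.2.2 * deriv (k ∘ h) Q.2.1.1 ^ (-r) ≠ 0 :=
      mul_ne_zero hb (zpow_ne_zero _ hkh.deriv_ne_zero)
    refine (hc.mk_eq_uniformizer_iff isAffineChart_snd hc.zero_mem).2
      ⟨k ∘ h, hkh, _, inv_ne_zero hw, ?_, (inv_mul_cancel₀ hw).symm⟩
    rw [ha, mul_zero]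
  · left
    refine ⟨Q.2.1.2.1⁻¹ * (Q.2.1.2.2 * deriv (k ∘ h) Q.2.1.1 ^ (-r)), ?_⟩
    exact (hc.mk_eq_uniformizer_iff isAffineChart_fst hc.zero_mem).2
      ⟨k ∘ h, hkh, _, inv_ne_zero ha, (inv_mul_cancel₀ ha).symm, rfl⟩

theorem uniformizer_fst_ne_uniformizer_snd (hc : S.IsLinearChart c n i ψ) (v : ℂ) :
    hc.uniformizer r isAffineChart_fst (0, v) ≠ hc.uniformizer r isAffineChart_snd (0, 0) := by
  intro h
  obtain ⟨ω, -, -, k, hk, h1, -⟩ := (hc.uniformizer_eq_uniformizer_iff isAffineChart_fst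
    isAffineChart_snd (p := (0, v)) (q := (0, 0)) hc.zero_mem hc.zero_mem).1 h
  exact hk (by simpa using h1.symm)

theorem isSingularPoint_iff (hc : S.IsLinearChart c n i ψ) {z : S.ProjBundle r}
    (hz : z.proj = c.toFun 0) : z.IsSingularPoint ↔ ¬ (n : ℤ) ∣ r ∧
      (z = hc.uniformizer r isAffineChart_fst (0, 0) ∨
        z = hc.uniformizer r isAffineChart_snd (0, 0)) := by
  constructor
  · intro hs
    rcases hc.exists_eq_uniformizer hz with ⟨v, rfl⟩ | rfl
    · have h := mt (hc.not_isSingularPoint_uniformizer isAffineChart_fst (hasWeight_fst r)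
        (v := v)) (not_not.2 hs)
      rw [not_or, not_not, dvd_neg] at h
      exact ⟨h.2, Or.inl (by rw [h.1])⟩
    · have h := mt (hc.not_isSingularPoint_uniformizer isAffineChart_snd (hasWeight_snd r)
        (v := 0)) (not_not.2 hs)
      rw [not_or] at h
      exact ⟨h.2, Or.inr rfl⟩
  · rintro ⟨hr, rfl | rfl⟩
    · exact hc.isSingularPoint_uniformizer_zero isAffineChart_fst (hasWeight_fst r) (by simpa)
    · exact hc.isSingularPoint_uniformizer_zero isAffineChart_snd (hasWeight_snd r) hr

/-- Isotropy can be computed in a linear chart. -/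
theorem hasNontrivialIsotropy_uniformizer_iff (hc : S.IsLinearChart c n i ψ)
    (hu : IsAffineChart u N V) {k : ℤ} (hk : HasWeight u r k) (v : ℂ) :
    (hc.uniformizer r hu (0, v)).HasNontrivialIsotropy ↔
      ∃ ω : ℂ, ω ^ n = 1 ∧ ω ≠ 1 ∧ v = ω ^ k * v := by
  constructor
  · rintro ⟨P, hP, g, hg1, hgz, t, ht, h1, h2⟩
    obtain ⟨h, hh, s, hs, h3, h4⟩ := (hc.mk_eq_uniformizer_iff hu hc.zero_mem).1 hP
    have hPd := P.2.2.1
    obtain ⟨t', ht', htd⟩ := hh.exists_conj (hgz ▸ (S.chart P.1).isTransition_act g hPd)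
    -- The isotropy of `P` acts on the tangent line by the same scalar as a rotation of the disc.
    obtain ⟨g', hg'⟩ := ht'.exists_eventuallyEq_act
    obtain ⟨ω, hω, hgω⟩ := hc.exists_act_eq g'
    have hder : deriv ((S.chart P.1).act g) P.2.1.1 = ω := by
      rw [← htd, hg'.deriv_eq, hgω]
      simp
    refine ⟨ω, hω, ?_, ?_⟩
    · rintro rfl
      refine hg1 (congrArg Subtype.val ((S.chart P.1).isotropyCharacter_injective hPd
        (a₁ := ⟨g, hgz⟩) (a₂ := 1) ?_))
      rw [map_one]
      exact hder
    · rw [← hk ω (hc.ne_zero_of_pow_eq_one hω)]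
      refine ⟨t, ht, ?_, ?_⟩
      · linear_combination (1 - t) * h3 + s * h1
      · rw [hder] at h2
        dsimp only at h4
        linear_combination (1 - t * ω ^ (-r)) * h4 + s * deriv h P.2.1.1 ^ (-r) * h2
  · rintro ⟨ω, hω, hω1, hv⟩
    obtain ⟨g', hg'⟩ := hc.exists_eq_act ω hω
    have htr := c.isTransition_act g' hc.zero_mem
    rw [hg', show (fun z : ℂ => ω * z) 0 = 0 from mul_zero ω] at htr
    obtain ⟨t', ht', htd⟩ := (hc.isTransition 0 hc.zero_mem).exists_conj htr
    obtain ⟨g, hg⟩ := ht'.exists_eventuallyEq_act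
    have hder : deriv ((S.chart i).act g) (ψ 0) = ω := by
      rw [← hg.deriv_eq, htd]
      simp
    obtain ⟨t, ht, h1, h2⟩ := (hk ω (hc.ne_zero_of_pow_eq_one hω) v v).2 hv
    refine ⟨⟨i, coordVector r ψ u (0, v), hc.coordVector_mem r hu hc.zero_mem⟩,
      (hc.uniformizer_of_mem hu hc.zero_mem).symm, g, ?_, ?_, t, ht, h1, ?_⟩
    · rintro rfl
      rw [(S.chart i).deriv_act_one ht'.mem_left] at hder
      exact hω1 hder.symm
    · exact hg.self_of_nhds.symm.trans ht'.map_eq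
    · simp only [coordVector, hder]
      linear_combination (deriv ψ 0 ^ (-r)) * h2

theorem hasNontrivialIsotropy_iff (hc : S.IsLinearChart c n i ψ) (hn : n ≠ 1)
    (hr : Int.gcd r n = 1) {z : S.ProjBundle r} (hz : z.proj = c.toFun 0) :
    z.HasNontrivialIsotropy ↔ z = hc.uniformizer r isAffineChart_fst (0, 0) ∨
        z = hc.uniformizer r isAffineChart_snd (0, 0) := by
  obtain ⟨ω, hω⟩ : ∃ ω : ℂ, IsPrimitiveRoot ω n := ⟨_, Complex.isPrimitiveRoot_exp n hc.ne_zero⟩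
  have hn1 : 1 < n := lt_of_le_of_ne (Nat.one_le_iff_ne_zero.2 hc.ne_zero) hn.symm
  constructor
  · intro h
    rcases hc.exists_eq_uniformizer hz with ⟨v, rfl⟩ | rfl
    · obtain ⟨ω, h1, h2, h3⟩ :=
        (hc.hasNontrivialIsotropy_uniformizer_iff isAffineChart_fst (hasWeight_fst r) v).1 h
      left
      by_cases hv : v = 0
      · rw [hv]
      refine absurd ?_ h2
      have h4 : ω ^ (-r) = 1 := mul_right_cancel₀ hv (by rw [← h3, one_mul])
      have h5 := pow_gcd_eq_one_iff.2 ⟨h4, h1⟩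
      rwa [Int.neg_gcd, hr, pow_one] at h5
    · exact Or.inr rfl
  · rintro (rfl | rfl)
    · exact (hc.hasNontrivialIsotropy_uniformizer_iff isAffineChart_fst (hasWeight_fst r) 0).2
        ⟨ω, hω.pow_eq_one, hω.ne_one hn1, by simp⟩
    · exact (hc.hasNontrivialIsotropy_uniformizer_iff isAffineChart_snd (hasWeight_snd r) 0).2
        ⟨ω, hω.pow_eq_one, hω.ne_one hn1, by simp⟩

end OrbifoldRiemannSurface.IsLinearChart

open OrbifoldRiemannSurface

/-- The structure of the surface along the fibre over `x`: at most two points of the fibre are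
singular, namely `[1 : 0]` and `[0 : 1]`. -/
theorem OrbifoldRiemannSurface.exists_fibre_points {X : Type u} [TopologicalSpace X]
    (S : OrbifoldRiemannSurface.{u, v} X) (r : ℤ) (x : X) :
    ∃ y z : S.ProjBundle r, y ≠ z ∧ y.proj = x ∧ z.proj = x ∧
      (∀ w : S.ProjBundle r, w.proj = x →
        (w.IsSingularPoint ↔ ¬ (S.order x : ℤ) ∣ r ∧ (w = y ∨ w = z))) ∧
      (S.order x ≠ 1 → Int.gcd r (S.order x) = 1 → ∀ w : S.ProjBundle r, w.proj = x →
        (w.HasNontrivialIsotropy ↔ w = y ∨ w = z)) ∧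
      (∀ m : ℕ, (m : ℤ) ≡ -r [ZMOD S.order x] →
        IsGermIso (ProjBundle.IsHolomorphicOn (S := S) (r := r))
          (HirzebruchJungQuotient.IsHolomorphicOn (p := m) (q := S.order x)) y
          (Quotient.mk (hirzebruchJungSetoid m (S.order x)) 0)) ∧
      (∀ m : ℕ, (m : ℤ) ≡ r [ZMOD S.order x] →
        IsGermIso (ProjBundle.IsHolomorphicOn (S := S) (r := r))
          (HirzebruchJungQuotient.IsHolomorphicOn (p := m) (q := S.order x)) z
          (Quotient.mk (hirzebruchJungSetoid m (S.order x)) 0)) := by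
  obtain ⟨c, ψ, hx, hc⟩ := S.exists_isLinearChart x
  refine ⟨hc.uniformizer r isAffineChart_fst (0, 0), hc.uniformizer r isAffineChart_snd (0, 0),
    hc.uniformizer_fst_ne_uniformizer_snd 0, ?_, ?_, fun w hw => ?_, fun h1 h2 w hw => ?_,
    fun m hm => ?_, fun m hm => ?_⟩
  · rw [hc.proj_uniformizer isAffineChart_fst hc.zero_mem, hx]
  · rw [hc.proj_uniformizer isAffineChart_snd hc.zero_mem, hx]
  · exact hc.isSingularPoint_iff (hw.trans hx.symm)
  · exact hc.hasNontrivialIsotropy_iff h1 h2 (hw.trans hx.symm)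
  · exact hc.isGermIso_hirzebruchJung isAffineChart_fst (IsLinearChart.hasWeight_fst r) hm
  · exact hc.isGermIso_hirzebruchJung isAffineChart_snd (IsLinearChart.hasWeight_snd r) hm

end

theorem mainTheorem7 {X : Type u} [TopologicalSpace X] [T2Space X] [CompactSpace X]
    [ConnectedSpace X] (S : OrbifoldRiemannSurface.{u, v} X)
    (hχ : S.orbifoldEulerChar < 0)
    (s : ℕ) (A : Fin s → X) (hA : Function.Injective A) (hcone : Set.range A = S.conePoints)
    (hq : ∀ k, 2 < S.order (A k)) (r : ℤ) :
    ((∀ k, ¬ (S.order (A k) : ℤ) ∣ r) →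
      {x : S.ProjBundle r | x.IsSingularPoint}.encard = 2 * s ∧
      ∀ k, {x : S.ProjBundle r | x.IsSingularPoint ∧ x.proj = A k}.encard = 2) ∧
    ∀ k, Int.gcd r (S.order (A k)) = 1 →
      ∃ x y : S.ProjBundle r, x ≠ y ∧
        {z : S.ProjBundle r | z.IsSingularPoint ∧ z.proj = A k} = {x, y} ∧
        {z : S.ProjBundle r | z.HasNontrivialIsotropy ∧ z.proj = A k} = {x, y} ∧
        ∃ p : ℕ, (p : ℤ) ≡ -r [ZMOD S.order (A k)] ∧
          x.IsOfTypeA p (S.order (A k)) ∧ y.IsOfTypeA (S.order (A k) - p) (S.order (A k)) := by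
  choose O I hne hO hI hsing hiso hgO hgI using fun x => S.exists_fibre_points r x
  have hfib : ∀ k, ¬ (S.order (A k) : ℤ) ∣ r →
      {x : S.ProjBundle r | x.IsSingularPoint ∧ x.proj = A k} = {O (A k), I (A k)} := by
    intro k hk
    ext x
    constructor
    · rintro ⟨h1, h2⟩
      exact ((hsing _ x h2).1 h1).2
    · rintro (rfl | rfl)
      · exact ⟨(hsing _ _ (hO _)).2 ⟨hk, Or.inl rfl⟩, hO _⟩
      · exact ⟨(hsing _ _ (hI _)).2 ⟨hk, Or.inr rfl⟩, hI _⟩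
  refine ⟨fun hr => ⟨?_, fun k => ?_⟩, fun k hk => ?_⟩
  · have hset : {x : S.ProjBundle r | x.IsSingularPoint} =
        Set.range (Sum.elim (fun k => O (A k)) fun k => I (A k)) := by
      ext x
      constructor
      · intro hx
        obtain ⟨h1, h2⟩ := (hsing _ x rfl).1 hx
        -- Over a point of order `1` the condition `¬ 1 ∣ r` fails.
        have hcp : x.proj ∈ Set.range A := by
          rw [hcone]
          intro h
          exact h1 (by simp [h])
        obtain ⟨k, hk⟩ := hcp
        rcases h2 with h2 | h2
        · exact ⟨Sum.inl k, by rw [h2, ← hk]; rfl⟩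
        · exact ⟨Sum.inr k, by rw [h2, ← hk]; rfl⟩
      · rintro ⟨k | k, rfl⟩
        · exact ((hfib k (hr k)).symm ▸ Set.mem_insert _ _ :
            O (A k) ∈ {x : S.ProjBundle r | x.IsSingularPoint ∧ x.proj = A k}).1
        · exact ((hfib k (hr k)).symm ▸ Set.mem_insert_of_mem _ rfl :
            I (A k) ∈ {x : S.ProjBundle r | x.IsSingularPoint ∧ x.proj = A k}).1
    have hinj : Function.Injective (Sum.elim (fun k => O (A k)) fun k => I (A k)) := by
      refine Function.Injective.sumElim (fun j k h => hA ?_) (fun j k h => hA ?_) fun j k h => ?_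
      · rw [← hO (A j), ← hO (A k)]
        exact congrArg _ h
      · rw [← hI (A j), ← hI (A k)]
        exact congrArg _ h
      · have hjk : A j = A k := by
          rw [← hO (A j), ← hI (A k)]
          exact congrArg _ h
        rw [hjk] at h
        exact hne _ h
    rw [hset, ← Set.image_univ, hinj.encard_image, Set.encard_univ]
    simp
    ring
  · rw [hfib k (hr k)]
    exact Set.encard_pair (hne _)
  · set n := S.order (A k) with hn
    have hn2 : 2 < n := hq k
    have hnr : ¬ (n : ℤ) ∣ r := fun h => by
      have h1 : n ∣ Int.gcd r n := Int.natCast_dvd_natCast.1 (Int.dvd_coe_gcd h dvd_rfl)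
      rw [hk, Nat.dvd_one] at h1
      lia
    refine ⟨O (A k), I (A k), hne _, hfib k hnr, ?_, ?_⟩
    · ext x
      constructor
      · rintro ⟨h1, h2⟩
        exact (hiso _ (by lia) hk x h2).1 h1
      · rintro (rfl | rfl)
        · exact ⟨(hiso _ (by lia) hk _ (hO _)).2 (Or.inl rfl), hO _⟩
        · exact ⟨(hiso _ (by lia) hk _ (hI _)).2 (Or.inr rfl), hI _⟩
    have hn0 : (n : ℤ) ≠ 0 := by lia
    obtain ⟨p, hp⟩ := Int.eq_ofNat_of_zero_le (Int.emod_nonneg (-r) hn0)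
    have hpr : (p : ℤ) ≡ -r [ZMOD n] := by
      rw [← hp]
      exact Int.mod_modEq _ _
    have hpn : p < n := by
      have := Int.emod_lt_of_pos (-r) (show (0 : ℤ) < n by lia)
      lia
    obtain ⟨t, ht⟩ := hpr.dvd
    have hcop : p.Coprime n := by
      have h1 := (Int.isCoprime_iff_gcd_eq_one.2 hk).neg_left.add_mul_left_left (-t)
      rw [show -r + n * -t = p by linear_combination ht] at h1
      exact Nat.isCoprime_iff_coprime.1 h1
    have hp0 : 0 < p := by
      rw [Nat.pos_iff_ne_zero]
      rintro rfl
      rw [Nat.coprime_zero_left] at hcop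
      lia
    refine ⟨p, hpr, ⟨hp0, hpn, hcop, hgO _ p hpr⟩,
      ⟨by lia, by lia, (Nat.coprime_self_sub_left hpn.le).2 hcop, hgI _ _ ?_⟩⟩
    rw [Nat.cast_sub hpn.le, Int.modEq_iff_dvd]
    exact ⟨-t - 1, by linear_combination -ht⟩
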